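/- Let $0<L<2\pi$ and let $\mathbb{T}^2=\mathbb{R}^2/(L\mathbb{Z})^2$. For $k\in\mathbb{Z}^2$ write $|k|=\max\{|k_1|,|k_2|\}$, $\lambda_k=(2\pi/L)^2(k_1^2+k_2^2)-1$ and $e_k(x)=L^{-1}e^{\mathrm{i}(2\pi/L)k\cdot x}$. For $N\in\mathbb{N}$, let $y=(y_k)_{0<|k|\le N}$ range over the complex vectors with $y_{-k}=\overline{y_k}$, identified isometrically with $\mathbb{R}^{(2N+1)^2-1}$ (so that $\sum_k|y_k|^2$ is the squared Euclidean norm), and let $\gamma_0^\perp$ be the Gaussian probability measure with density $$\Bigl(\prod_{0<|k|\le N}\sqrt{2\pi/\lambda_k}\Bigr)^{-1}\exp\Bigl(-\tfrac12\sum_{0<|k|\le N}\lambda_k|y_k|^2\Bigr)$$ with respect to Lebesgue measure. Set $$\hat\phi_{N,\perp}(x)=\sum_{0<|k|\le N}y_k e_k(x),\qquad C_N^\perp=\frac1{L^2}\sum_{0<|k|\le N}\frac1{\lambda_k},\qquad U_{n,N}^\perp=\int_{\mathbb{T}^2}H_n(\hat\phi_{N,\perp}(x),C_N^\perp)\,dx,$$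 where the Hermite polynomials are given by $H_0=1$, $H_n(X,C)=XH_{n-1}(X,C)-C\,\partial_XH_{n-1}(X,C)$. For $\mu,z_0\in\mathbb{R}$ and $\varepsilon>0$ let $$w_{N,\perp}^{(\mu)}(z_0,y)=\frac{3z_0^2}{2L^2}U_{2,N}^\perp+\mu\Bigl(-\frac{3\varepsilon}{2L^2}U_{2,N}^\perp+\frac{z_0}{L}\sqrt{\varepsilon}\,U_{3,N}^\perp+\frac14\varepsilon\,U_{4,N}^\perp\Bigr).$$ Then for every $\mu\in(0,\tfrac32)$ there exist constants $M(\mu)>0$ and $\varepsilon_0(\mu)>0$ (they may also depend on the fixed $L$, but not on $N$, $\varepsilon$, $z_0$) such that for all $N\in\mathbb{N}$, all $\varepsilon\in(0,\varepsilon_0(\mu))$ and all $z_0\in\mathbb{R}$, the function $e^{-w_{N,\perp}^{(\mu)}(z_0,\cdot)}$ is $\gamma_0^\perp$-integrable and $$\mathbb{E}_{\gamma_0^\perp}\bigl[e^{-w_{N,\perp}^{(\mu)}(z_0,\cdot)}\bigr]\le M(\mu)\Bigl[1+\sqrt{\varepsilon}\,e^{M(\mu)z_0^2\log(1+z_0^2)/\sqrt{\varepsilon}}\Bigr].$$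 -/

import Mathlib

open MeasureTheory
open scoped Polynomial

noncomputable section

namespace AllenCahn

/-- The eigenvalue `λ_k = (2π/L)² (k₁² + k₂²) - 1` of `-Δ - 1` on the torus of size `L × L`. -/
def eig (L : ℝ) (k : ℤ × ℤ) : ℝ :=
  (2 * Real.pi / L) ^ 2 * ((k.1 : ℝ) ^ 2 + (k.2 : ℝ) ^ 2) - 1

/-- The wave vectors `k ∈ ℤ²` with `0 < |k| ≤ N`, where `|k| = max {|k₁|, |k₂|}`. -/
def modes (N : ℕ) : Finset (ℤ × ℤ) :=
  (Finset.Icc (-(N : ℤ)) N ×ˢ Finset.Icc (-(N : ℤ)) N).filter (fun k => 0 < max |k.1| |k.2|)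

theorem mem_modes {N : ℕ} {k : ℤ × ℤ} :
    k ∈ modes N ↔ 0 < max |k.1| |k.2| ∧ max |k.1| |k.2| ≤ N := by
  simp only [modes, Finset.mem_filter, Finset.mem_product, Finset.mem_Icc, max_le_iff, abs_le]
  tauto

/-- The wave vector `-k`. -/
def negMode {N : ℕ} (k : modes N) : modes N :=
  ⟨-k.1, by
    have h := mem_modes.1 k.2
    exact mem_modes.2 (by simpa using h)⟩

/-- A choice of one wave vector in each pair `{k, -k}`, `k ≠ 0`. -/
def IsPositive (k : ℤ × ℤ) : Prop := 0 < k.1 ∨ (k.1 = 0 ∧ 0 < k.2)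

instance (k : ℤ × ℤ) : Decidable (IsPositive k) := by
  unfold IsPositive; infer_instance

/-- The complex Fourier coefficients `y_k`, `0 < |k| ≤ N`, with `y_{-k} = conj y_k`, are identified
with a vector `v` of real coordinates through `y_k = (v_k + i v_{-k}) / √2` and
`y_{-k} = (v_k - i v_{-k}) / √2` for `k` positive. This is a linear isometry:
`∑ |y_k|² = ∑ v_k²`. -/
def coeff {N : ℕ} (v : modes N → ℝ) (k : modes N) : ℂ :=
  if IsPositive k.1 then ((v k : ℂ) + Complex.I * (v (negMode k) : ℂ)) / (√2 : ℝ)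
  else ((v (negMode k) : ℂ) - Complex.I * (v k : ℂ)) / (√2 : ℝ)

/-- The torus `𝕋² = ℝ² / (L ℤ)²`; its volume measure is Lebesgue measure, of total mass `L²`. -/
abbrev Torus (L : ℝ) : Type := AddCircle L × AddCircle L

/-- The Fourier basis function `e_k(x) = L⁻¹ exp(i (2π/L) k · x)`. -/
def basisFun (L : ℝ) (k : ℤ × ℤ) (x : Torus L) : ℂ :=
  (L : ℂ)⁻¹ * (fourier k.1 x.1 * fourier k.2 x.2)

/-- The fluctuating field `∑_{0 < |k| ≤ N} y_k e_k(x)`. The sum is real, see `ofReal_field`. -/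
def field (L : ℝ) (N : ℕ) (v : modes N → ℝ) (x : Torus L) : ℝ :=
  (∑ k : modes N, coeff v k * basisFun L k.1 x).re

/-- The quadratic form `g(y) = ½ ∑_{0 < |k| ≤ N} λ_k |y_k|²`. -/
def quadForm (L : ℝ) (N : ℕ) (v : modes N → ℝ) : ℝ :=
  (1 / 2) * ∑ k : modes N, eig L k.1 * ‖coeff v k‖ ^ 2

/-- The centred Gaussian measure with density `exp(-g(y))` with respect to Lebesgue measure,
divided by the normalisation `∏_{0 < |k| ≤ N} √(2π / λ_k)`. -/
def gaussPerp (L : ℝ) (N : ℕ) : Measure (modes N → ℝ) :=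
  volume.withDensity fun v => ENNReal.ofReal
    (Real.exp (-quadForm L N v) / ∏ k : modes N, √(2 * Real.pi / eig L k.1))

/-- The renormalisation constant `L⁻² ∑_{0 < |k| ≤ N} 1 / λ_k`. -/
def renormConst (L : ℝ) (N : ℕ) : ℝ :=
  1 / L ^ 2 * ∑ k : modes N, 1 / eig L k.1

/-- The Hermite polynomials `H_n(X, C)` with variance parameter `C`:
`H_0 = 1` and `H_{n+1} = X H_n - C ∂_X H_n`. -/
def hermiteC (C : ℝ) : ℕ → ℝ[X]
  | 0 => 1
  | n + 1 => Polynomial.X * hermiteC C n - Polynomial.C C * Polynomial.derivative (hermiteC C n)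

/-- The integrated Wick power `U_n = ∫_{𝕋²} H_n(field(x), renormConst) dx`. -/
def wickInt (L : ℝ) [Fact (0 < L)] (N n : ℕ) (v : modes N → ℝ) : ℝ :=
  ∫ x : Torus L, (hermiteC (renormConst L N) n).eval (field L N v x)

/-- The interaction
`w(z₀, y) = (3 z₀² / 2L²) U_2 + μ (-(3ε / 2L²) U_2 + (z₀ / L) √ε U_3 + (ε / 4) U_4)`. -/
def interaction (L : ℝ) [Fact (0 < L)] (N : ℕ) (μ ε z₀ : ℝ) (v : modes N → ℝ) : ℝ :=
  3 * z₀ ^ 2 / (2 * L ^ 2) * wickInt L N 2 v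
    + μ * (-(3 * ε / (2 * L ^ 2)) * wickInt L N 2 v + z₀ / L * √ε * wickInt L N 3 v
      + 1 / 4 * ε * wickInt L N 4 v)

theorem negMode_negMode {N : ℕ} (k : modes N) : negMode (negMode k) = k :=
  Subtype.ext (neg_neg k.1)

theorem isPositive_negMode {N : ℕ} (k : modes N) :
    IsPositive (negMode k).1 ↔ ¬ IsPositive k.1 := by
  have h := (mem_modes.1 k.2).1
  simp only [lt_max_iff, abs_pos] at h
  simp only [IsPositive, negMode, Prod.fst_neg, Prod.snd_neg]
  omega

theorem coeff_negMode {N : ℕ} (v : modes N → ℝ) (k : modes N) :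
    coeff v (negMode k) = (starRingEnd ℂ) (coeff v k) := by
  by_cases h : IsPositive k.1
  · have h' : ¬ IsPositive (negMode k).1 := fun h2 => (isPositive_negMode k).1 h2 h
    simp [coeff, h, h', negMode_negMode, sub_eq_add_neg]
  · have h' : IsPositive (negMode k).1 := (isPositive_negMode k).2 h
    simp [coeff, h, h', negMode_negMode]

theorem ofReal_field (L : ℝ) (N : ℕ) (v : modes N → ℝ) (x : Torus L) :
    (field L N v x : ℂ) = ∑ k : modes N, coeff v k * basisFun L k.1 x := by
  refine Complex.conj_eq_iff_re.1 ?_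
  rw [map_sum]
  refine Fintype.sum_equiv (Function.Involutive.toPerm negMode negMode_negMode) _ _ fun k => ?_
  change _ = coeff v (negMode k) * basisFun L (-k.1) x
  simp only [coeff_negMode, map_mul, basisFun, Prod.fst_neg, Prod.snd_neg, fourier_neg,
    map_inv₀, Complex.conj_ofReal]

end AllenCahn

end

/-!
This is Nelson's argument for the exponential integrability of the `P(φ)₂` interaction, with the
dependence on `z₀` kept track of. Truncate the field at frequency `M`, and let `w_M` be the
interaction of the truncated field.

*Lower bound.* For `0 < μ < 3/2` the quadratic form `3/2 a² + μ a b + μ/4 b²` is positive definite,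
so the potential without counterterms is positive, and the Wick counterterms give
`w_M ≥ -K (z₀² (1 + log M) + (1 + log M)²)`, as the variance of the truncated field is `O(log M)`
(`wick_potential_lower_bound`, `exists_truncInteraction_lower_bound`).

*Moments of the difference.* An integrated Wick power of `X` is the average over an independent
copy `Y` of the integrated ordinary power of `X + i Y` (`integral_tensorPoly_eq`). By Jensen's
inequality its even moments are bounded by those of a homogeneous holomorphic polynomial in
independent complex Gaussian variables. Powers of such polynomials are of the same kind, and
monomials in them are orthogonal, so that all moments are controlled by the Hilbert-Schmidt norm of
the coefficient tensor, up to powers of a factorial (`integral_norm_sq_holomorphic_le`,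
`integral_norm_tensorPoly_pow_le`). This replaces hypercontractivity. For the difference between
the full and the truncated Wick power, the tensor is supported on wave vectors that add up to zero,
up to signs, and one of which exceeds `M`; its norm is `O(M ^ (-1/2))` by the summability of
`|k| ^ (-5/2)` over `ℤ²` (`sum_inv_sq_momentum_le`). Altogether the moments of order `2 p` of
`w - w_M` are at most `3 (B (1 + z₀²)² p ^ 12 M ^ (-1/2)) ^ p`
(`exists_interaction_moment_bound`).

*Conclusion.* Use the levels `M = j ^ 80` and the exponents `p = j ^ 3`. On the event that level
`j + 1` is the first one with `|w - w_M| ≤ 1`, the lower bound gives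
`exp (-w) ≤ exp (O(j²))`, while the moments show that the event has probability `O(exp (-j³))`;
both hold as soon as `j` exceeds `1 + z₀²` and a constant. The first such level contributes
`exp (O(z₀² log (1 + z₀²) + 1))` and the others a bounded amount (`exists_nelson_bound`), which is a
bound uniform in `ε < 1` (`exists_exp_bound`) and stronger than the one claimed.
-/

noncomputable section

namespace AllenCahn

open ProbabilityTheory
open scoped NNReal ENNReal Nat ComplexConjugate

/-! ### Complex Gaussian variables -/

/-- The point `x + i y` of the complex plane with coordinates `(x, y)`. -/
def toC (x : ℝ × ℝ) : ℂ := x.1 + x.2 * Complex.I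

/-- The law of the coordinates of a rotation invariant complex Gaussian variable, whose real and
imaginary parts are independent centred Gaussian variables of variance `s`. -/
abbrev planeGaussian (s : ℝ≥0) : Measure (ℝ × ℝ) := (gaussianReal 0 s).prod (gaussianReal 0 s)

theorem continuous_toC : Continuous toC := by unfold toC; fun_prop

theorem norm_toC_sq (x : ℝ × ℝ) : ‖toC x‖ ^ 2 = x.1 ^ 2 + x.2 ^ 2 := by
  rw [toC, Complex.sq_norm, Complex.normSq_add_mul_I]

theorem norm_toC_le (x : ℝ × ℝ) : ‖toC x‖ ≤ 2 * ‖x‖ := by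
  have h1 : |x.1| ≤ ‖x‖ := norm_fst_le x
  have h2 : |x.2| ≤ ‖x‖ := norm_snd_le x
  calc ‖toC x‖ ≤ ‖(x.1 : ℂ)‖ + ‖(x.2 : ℂ) * Complex.I‖ := norm_add_le _ _
    _ = |x.1| + |x.2| := by simp
    _ ≤ 2 * ‖x‖ := by linarith

theorem integrable_norm_toC_pow (s : ℝ≥0) (n : ℕ) :
    Integrable (fun x => ‖toC x‖ ^ n) (planeGaussian s) := by
  have h := ((IsGaussian.memLp_id (planeGaussian s) n (by simp)).integrable_norm_pow').const_mul
    (2 ^ n)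
  refine h.mono' (by have := continuous_toC; fun_prop) (ae_of_all _ fun x => ?_)
  rw [Real.norm_of_nonneg (by positivity), ← mul_pow]
  exact pow_le_pow_left₀ (norm_nonneg _) (norm_toC_le x) n

theorem integrable_toC_monomial (s : ℝ≥0) (a b : ℕ) :
    Integrable (fun x => toC x ^ a * conj (toC x) ^ b) (planeGaussian s) := by
  refine (integrable_norm_toC_pow s (a + b)).mono' ?_ (ae_of_all _ fun x => ?_)
  · have := continuous_toC
    exact Continuous.aestronglyMeasurable (by fun_prop)
  · rw [norm_mul, norm_pow, norm_pow, RCLike.norm_conj, pow_add]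

theorem toC_rotation (θ : ℝ) (x : ℝ × ℝ) :
    toC (ContinuousLinearMap.rotation θ x) = Complex.exp (-(θ * Complex.I)) * toC x := by
  rw [ContinuousLinearMap.rotation_apply, ← neg_mul, Complex.exp_mul_I, Complex.cos_neg,
    Complex.sin_neg]
  simp only [toC, smul_eq_mul]
  push_cast
  linear_combination (Complex.sin θ * x.2) * Complex.I_mul_I

/-- Rotation by the angle `π / (a - b)` changes the sign of `Z ^ a * conj Z ^ b`. -/
theorem integral_toC_monomial_of_ne (s : ℝ≥0) {a b : ℕ} (hab : a ≠ b) :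
    ∫ x, toC x ^ a * conj (toC x) ^ b ∂(planeGaussian s) = 0 := by
  have hne : ((a : ℂ) - b) ≠ 0 := sub_ne_zero.2 (by exact_mod_cast hab)
  set θ : ℝ := Real.pi / ((a : ℝ) - b) with hθ
  have hrot : (planeGaussian s).map (ContinuousLinearMap.rotation θ) = planeGaussian s :=
    IsGaussian.map_rotation_eq_self (by simp) θ
  have h1 : ∫ x, toC x ^ a * conj (toC x) ^ b ∂(planeGaussian s)
      = ∫ x, toC (ContinuousLinearMap.rotation θ x) ^ a
          * conj (toC (ContinuousLinearMap.rotation θ x)) ^ b ∂(planeGaussian s) := by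
    conv_lhs => rw [← hrot]
    rw [integral_map (by fun_prop)]
    have := continuous_toC
    exact Continuous.aestronglyMeasurable (by fun_prop)
  have h2 : ∀ x, toC (ContinuousLinearMap.rotation θ x) ^ a
      * conj (toC (ContinuousLinearMap.rotation θ x)) ^ b
      = -(toC x ^ a * conj (toC x) ^ b) := by
    intro x
    rw [toC_rotation, map_mul, ← Complex.exp_conj, mul_pow, mul_pow, ← Complex.exp_nat_mul,
      ← Complex.exp_nat_mul]
    have : Complex.exp (a * -(θ * Complex.I)) * Complex.exp (b * conj (-(θ * Complex.I))) = -1 := by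
      rw [← Complex.exp_add]
      have : (a * -(θ * Complex.I) + b * conj (-(θ * Complex.I)) : ℂ)
          = -(Real.pi * Complex.I) := by
        rw [map_neg, map_mul, Complex.conj_I, Complex.conj_ofReal, hθ]
        push_cast
        field_simp
        ring
      rw [this, Complex.exp_neg, Complex.exp_pi_mul_I]
      norm_num
    linear_combination (toC x ^ a * conj (toC x) ^ b) * this
  simp_rw [h2, integral_neg] at h1
  exact self_eq_neg.1 h1

theorem integral_even_pow_gaussianReal_le (s : ℝ≥0) (a : ℕ) :
    ∫ x, x ^ (2 * a) ∂(gaussianReal 0 s) ≤ 2 * (4 * s) ^ a * (a ! : ℝ) ^ 2 := by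
  have hmap : gaussianReal 0 s = (gaussianReal 0 1).map (fun x => √s * x) := by
    rw [gaussianReal_map_const_mul]
    congr 1
    · simp
    · ext; simp
  have hint : Integrable (fun x : ℝ => Real.exp (1 * x) + Real.exp (-1 * x)) (gaussianReal 0 1) :=
    (integrable_exp_mul_gaussianReal 1).add (integrable_exp_mul_gaussianReal (-1))
  have hle : ∫ x, x ^ (2 * a) ∂(gaussianReal 0 1)
      ≤ ∫ x, ((2 * a)! : ℝ) * ((Real.exp (1 * x) + Real.exp (-1 * x)) / 2) ∂(gaussianReal 0 1) := by
    refine integral_mono_of_nonneg (ae_of_all _ fun x => (even_two_mul a).pow_nonneg x)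
      ((hint.div_const 2).const_mul _) (ae_of_all _ fun x => ?_)
    have := le_hasSum (Real.hasSum_cosh x) a fun n _ =>
      div_nonneg ((even_two_mul n).pow_nonneg x) (by positivity)
    rw [div_le_iff₀' (by positivity), Real.cosh_eq] at this
    simpa using this
  have hexp : ∫ x, ((2 * a)! : ℝ) * ((Real.exp (1 * x) + Real.exp (-1 * x)) / 2)
      ∂(gaussianReal 0 1) = (2 * a)! * Real.exp (1 / 2) := by
    rw [integral_const_mul, integral_div, integral_add (integrable_exp_mul_gaussianReal 1)
      (integrable_exp_mul_gaussianReal (-1))]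
    have h1 := congrFun (mgf_fun_id_gaussianReal (μ := 0) (v := 1)) 1
    have h2 := congrFun (mgf_fun_id_gaussianReal (μ := 0) (v := 1)) (-1)
    simp only [mgf] at h1 h2
    rw [h1, h2]
    norm_num
  have hfac : (((2 * a)! : ℕ) : ℝ) ≤ 4 ^ a * (a ! : ℝ) ^ 2 := by
    have h1 := Nat.choose_mul_factorial_mul_factorial (n := 2 * a) (k := a) (by omega)
    have h2 : (2 * a).choose a ≤ 4 ^ a := by
      simpa [pow_mul] using Nat.choose_le_two_pow (2 * a) a
    rw [show 2 * a - a = a by omega, mul_assoc, ← sq] at h1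
    rw [← h1]
    exact_mod_cast Nat.mul_le_mul_right _ h2
  have he : Real.exp (1 / 2) ≤ 2 := by
    have := Real.exp_one_lt_d9
    have h2 : Real.exp (1 / 2) ^ 2 = Real.exp 1 := by rw [← Real.exp_nat_mul]; norm_num
    nlinarith [Real.exp_pos (1 / 2)]
  rw [hmap, integral_map (by fun_prop) (by fun_prop)]
  simp_rw [mul_pow, integral_const_mul, pow_mul, Real.sq_sqrt s.coe_nonneg]
  simp_rw [← pow_mul]
  calc (s : ℝ) ^ a * ∫ x, x ^ (2 * a) ∂(gaussianReal 0 1)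
      ≤ (s : ℝ) ^ a * ((4 ^ a * (a ! : ℝ) ^ 2) * 2) := by
        gcongr
        exact hle.trans (hexp.le.trans (by gcongr))
    _ = 2 * (4 ^ a * s ^ a) * (a ! : ℝ) ^ 2 := by ring

theorem integral_norm_toC_pow_le (s : ℝ≥0) (a : ℕ) :
    ∫ x, ‖toC x‖ ^ (2 * a) ∂(planeGaussian s) ≤ 16 ^ a * (a ! : ℝ) ^ 2 * s ^ a := by
  rcases Nat.eq_zero_or_pos a with rfl | ha
  · simp
  have hX : Integrable (fun x : ℝ => x ^ (2 * a)) (gaussianReal 0 s) := by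
    have := (memLp_id_gaussianReal' (μ := 0) (v := s) ((2 * a : ℕ) : ℝ≥0∞)
      (ENNReal.natCast_ne_top _)).integrable_norm_pow'
    refine this.congr (ae_of_all _ fun x => ?_)
    simp [(even_two_mul a).pow_abs]
  have h1 : Integrable (fun x : ℝ × ℝ => x.1 ^ (2 * a)) (planeGaussian s) := hX.comp_fst _
  have h2 : Integrable (fun x : ℝ × ℝ => x.2 ^ (2 * a)) (planeGaussian s) := hX.comp_snd _
  have hle : ∫ x, ‖toC x‖ ^ (2 * a) ∂(planeGaussian s)
      ≤ ∫ x, 2 ^ (a - 1) * (x.1 ^ (2 * a) + x.2 ^ (2 * a)) ∂(planeGaussian s) := by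
    refine integral_mono (integrable_norm_toC_pow s _) ((h1.add h2).const_mul _) fun x => ?_
    simp only [pow_mul, norm_toC_sq]
    exact add_pow_le (sq_nonneg _) (sq_nonneg _) a
  refine hle.trans ?_
  rw [integral_const_mul, integral_add h1 h2,
    integral_fun_fst (fun x : ℝ => x ^ (2 * a)), integral_fun_snd (fun x : ℝ => x ^ (2 * a))]
  simp only [probReal_univ, one_smul]
  have hm := integral_even_pow_gaussianReal_le s a
  have h2a : (2 : ℝ) ^ a = 2 ^ (a - 1) * 2 := by rw [← pow_succ]; congr 1; omega
  have h2b : (2 : ℝ) ≤ 2 ^ a := by simpa using pow_le_pow_right₀ (one_le_two (α := ℝ)) ha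
  calc (2 : ℝ) ^ (a - 1) * (∫ x, x ^ (2 * a) ∂(gaussianReal 0 s)
        + ∫ x, x ^ (2 * a) ∂(gaussianReal 0 s))
      = 2 ^ a * ∫ x, x ^ (2 * a) ∂(gaussianReal 0 s) := by rw [h2a]; ring
    _ ≤ 2 ^ a * (2 ^ a * (4 * s) ^ a * (a ! : ℝ) ^ 2) := by
        gcongr; exact hm.trans (by gcongr)
    _ = 16 ^ a * (a ! : ℝ) ^ 2 * s ^ a := by
        rw [mul_pow, show (16 : ℝ) = 2 * 2 * 4 by norm_num, mul_pow, mul_pow]; ring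

theorem ofReal_norm_sq_holomorphic {ι J : Type*} [Fintype ι] [Fintype J] [DecidableEq J]
    (T : (J → ι) → ℂ) (z : ι → ℝ × ℝ) :
    ((‖∑ κ, T κ * ∏ j, toC (z (κ j))‖ ^ 2 : ℝ) : ℂ)
      = ∑ κ, ∑ κ', T κ * conj (T κ')
        * ((∏ j, toC (z (κ j))) * conj (∏ j, toC (z (κ' j)))) := by
  rw [Complex.ofReal_pow, ← Complex.conj_mul', mul_comm, map_sum, Finset.sum_mul_sum]
  simp only [map_mul]
  refine Finset.sum_congr rfl fun κ _ => Finset.sum_congr rfl fun κ' _ => ?_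
  ring

section Multi

variable {ι J : Type*} [DecidableEq ι] [Fintype J]

/-- The number of times that `k` occurs among the values of `κ`. -/
def mult (κ : J → ι) (k : ι) : ℕ := Finset.card {j | κ j = k}

theorem prod_comp_eq_prod_pow_mult [Fintype ι] {R : Type*} [CommMonoid R] (f : ι → R) (κ : J → ι) :
    ∏ j, f (κ j) = ∏ k, f k ^ mult κ k := by
  rw [← Finset.prod_fiberwise Finset.univ κ]
  refine Finset.prod_congr rfl fun k _ => ?_
  rw [mult, ← Finset.prod_const]
  exact Finset.prod_congr rfl fun j hj => by rw [(Finset.mem_filter.1 hj).2]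

theorem sum_mult [Fintype ι] (κ : J → ι) : ∑ k, mult κ k = Fintype.card J := by
  simpa [mult] using (Finset.card_eq_sum_card_fiberwise (s := Finset.univ) (t := Finset.univ)
    (f := κ) (by simp)).symm

theorem exists_perm_of_mult_eq {κ κ' : J → ι} (h : mult κ = mult κ') :
    ∃ e : Equiv.Perm J, κ' = κ ∘ e := by
  have hk : ∀ k, Nonempty ({j // κ' j = k} ≃ {j // κ j = k}) := fun k => by
    refine Fintype.card_eq.1 ?_
    have := congrFun h k
    simp only [mult] at this
    rw [Fintype.card_subtype, Fintype.card_subtype, this]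
  have e := fun k => (hk k).some
  exact ⟨Equiv.ofFiberEquiv e, funext fun j => (Equiv.ofFiberEquiv_map e j).symm⟩

theorem card_mult_eq_le [Fintype ι] [DecidableEq J] (κ : J → ι) :
    Finset.card {κ' : J → ι | mult κ = mult κ'} ≤ (Fintype.card J)! := by
  rw [← Fintype.card_perm]
  refine (Finset.card_le_card (t := Finset.univ.image fun e : Equiv.Perm J => κ ∘ e) ?_).trans
    (Finset.card_image_le.trans_eq Finset.card_univ)
  intro κ' h
  obtain ⟨e, he⟩ := exists_perm_of_mult_eq (Finset.mem_filter.1 h).2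
  exact Finset.mem_image.2 ⟨e, Finset.mem_univ _, he.symm⟩

variable [Fintype ι] (s : ι → ℝ≥0)

/-- The law of the coordinates of independent complex Gaussian variables. -/
abbrev complexGaussian : Measure (ι → ℝ × ℝ) := Measure.pi fun k => planeGaussian (s k)

theorem monomial_mul_conj (κ κ' : J → ι) (z : ι → ℝ × ℝ) :
    (∏ j, toC (z (κ j))) * conj (∏ j, toC (z (κ' j)))
      = ∏ k, toC (z k) ^ mult κ k * conj (toC (z k)) ^ mult κ' k := by
  rw [map_prod, prod_comp_eq_prod_pow_mult (fun k => toC (z k)),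
    prod_comp_eq_prod_pow_mult (fun k => conj (toC (z k))), Finset.prod_mul_distrib]

theorem integrable_monomial_mul_conj (κ κ' : J → ι) :
    Integrable (fun z : ι → ℝ × ℝ => (∏ j, toC (z (κ j))) * conj (∏ j, toC (z (κ' j))))
      (complexGaussian s) := by
  simp_rw [monomial_mul_conj]
  exact Integrable.fintype_prod (f := fun k x => toC x ^ mult κ k * conj (toC x) ^ mult κ' k)
    fun k => integrable_toC_monomial (s k) _ _

theorem integral_monomial_mul_conj_of_ne {κ κ' : J → ι} (h : mult κ ≠ mult κ') :
    ∫ z, (∏ j, toC (z (κ j))) * conj (∏ j, toC (z (κ' j))) ∂(complexGaussian s) = 0 := by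
  simp_rw [monomial_mul_conj]
  rw [integral_fintype_prod_eq_prod
    (fun k x => toC x ^ mult κ k * conj (toC x) ^ mult κ' k)]
  obtain ⟨k, hk⟩ := Function.ne_iff.1 h
  exact Finset.prod_eq_zero (Finset.mem_univ k) (integral_toC_monomial_of_ne (s k) hk)

theorem norm_integral_monomial_mul_conj_le {κ κ' : J → ι} (h : mult κ = mult κ') :
    ‖∫ z, (∏ j, toC (z (κ j))) * conj (∏ j, toC (z (κ' j))) ∂(complexGaussian s)‖
      ≤ 16 ^ Fintype.card J * ((Fintype.card J)! : ℝ) ^ 2 * ∏ j, (s (κ j) : ℝ) := by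
  simp_rw [monomial_mul_conj]
  rw [integral_fintype_prod_eq_prod
    (fun k x => toC x ^ mult κ k * conj (toC x) ^ mult κ' k), norm_prod]
  calc ∏ k, ‖∫ x, toC x ^ mult κ k * conj (toC x) ^ mult κ' k ∂(planeGaussian (s k))‖
      ≤ ∏ k, (16 ^ mult κ k * ((mult κ k)! : ℝ) ^ 2 * (s k : ℝ) ^ mult κ k) := by
        refine Finset.prod_le_prod (fun _ _ => norm_nonneg _) fun k _ => ?_
        refine (norm_integral_le_integral_norm _).trans ?_
        refine le_trans (le_of_eq ?_) (integral_norm_toC_pow_le (s k) (mult κ k))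
        refine integral_congr_ae (ae_of_all _ fun x => ?_)
        simp only [norm_mul, norm_pow, RCLike.norm_conj, ← congrFun h k]
        ring
    _ = 16 ^ Fintype.card J * (∏ k, ((mult κ k)! : ℝ)) ^ 2 * ∏ j, (s (κ j) : ℝ) := by
        rw [Finset.prod_mul_distrib, Finset.prod_mul_distrib, Finset.prod_pow_eq_pow_sum, sum_mult,
          Finset.prod_pow, prod_comp_eq_prod_pow_mult (fun k => (s k : ℝ))]
    _ ≤ _ := by
        have : (∏ k, (mult κ k)!) ≤ (Fintype.card J)! := by
          rw [← sum_mult κ]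
          exact Nat.le_of_dvd (Nat.factorial_pos _) (Nat.prod_factorial_dvd_factorial_sum _ _)
        gcongr
        exact_mod_cast this

/-- Second moment of a homogeneous holomorphic polynomial in independent complex Gaussian
variables. Two monomials are orthogonal unless they agree up to a permutation of the factors,
which leaves at most `m!` partners for each of them. The power of `m!` is not optimal. -/
theorem integral_norm_sq_holomorphic_le [DecidableEq J] (T : (J → ι) → ℂ) :
    ∫ z, ‖∑ κ, T κ * ∏ j, toC (z (κ j))‖ ^ 2 ∂(complexGaussian s)
      ≤ 16 ^ Fintype.card J * ((Fintype.card J)! : ℝ) ^ 3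
        * ∑ κ, ‖T κ‖ ^ 2 * ∏ j, (s (κ j) : ℝ) := by
  set E : (J → ι) → (J → ι) → ℂ := fun κ κ' =>
    ∫ z, (∏ j, toC (z (κ j))) * conj (∏ j, toC (z (κ' j))) ∂(complexGaussian s) with hE
  set c : ℝ := 16 ^ Fintype.card J * ((Fintype.card J)! : ℝ) ^ 2 with hc
  have hc0 : 0 ≤ c := by positivity
  set V : (J → ι) → ℝ := fun κ => ∏ j, (s (κ j) : ℝ) with hV
  have hV0 : ∀ κ, 0 ≤ V κ := fun κ => Finset.prod_nonneg fun _ _ => NNReal.coe_nonneg _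
  have hexp : ((∫ z, ‖∑ κ, T κ * ∏ j, toC (z (κ j))‖ ^ 2 ∂(complexGaussian s) : ℝ) : ℂ)
      = ∑ κ, ∑ κ', T κ * conj (T κ') * E κ κ' := by
    rw [← integral_complex_ofReal]
    simp_rw [ofReal_norm_sq_holomorphic]
    rw [integral_finsetSum _ fun κ _ => integrable_finsetSum _ fun κ' _ =>
      (integrable_monomial_mul_conj s κ κ').const_mul _]
    refine Finset.sum_congr rfl fun κ _ => ?_
    rw [integral_finsetSum _ fun κ' _ => (integrable_monomial_mul_conj s κ κ').const_mul _]
    simp_rw [integral_const_mul, hE]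
  have hterm : ∀ κ κ', ‖T κ * conj (T κ') * E κ κ'‖
      ≤ if mult κ = mult κ' then c / 2 * (‖T κ‖ ^ 2 * V κ) + c / 2 * (‖T κ'‖ ^ 2 * V κ')
        else 0 := by
    intro κ κ'
    split_ifs with h
    · have hVV : V κ' = V κ := by
        simp only [hV, prod_comp_eq_prod_pow_mult (fun k => (s k : ℝ)), h]
      rw [norm_mul, norm_mul, RCLike.norm_conj, hVV]
      calc ‖T κ‖ * ‖T κ'‖ * ‖E κ κ'‖ ≤ ‖T κ‖ * ‖T κ'‖ * (c * V κ) := by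
            gcongr
            exact norm_integral_monomial_mul_conj_le s h
        _ ≤ _ := by
            have := mul_nonneg (mul_nonneg hc0 (hV0 κ)) (sq_nonneg (‖T κ‖ - ‖T κ'‖))
            linarith
    · have : E κ κ' = 0 := integral_monomial_mul_conj_of_ne s h
      simp [this]
  have hnn : 0 ≤ ∫ z, ‖∑ κ, T κ * ∏ j, toC (z (κ j))‖ ^ 2 ∂(complexGaussian s) :=
    integral_nonneg fun z => by positivity
  have hsymm :
      (∑ κ : J → ι, ∑ κ' : J → ι, if mult κ = mult κ' then c / 2 * (‖T κ'‖ ^ 2 * V κ') else 0)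
      = ∑ κ : J → ι, ∑ κ' : J → ι, if mult κ = mult κ' then c / 2 * (‖T κ‖ ^ 2 * V κ) else 0 := by
    rw [Finset.sum_comm]
    exact Finset.sum_congr rfl fun κ _ => Finset.sum_congr rfl fun κ' _ =>
      if_congr eq_comm rfl rfl
  calc ∫ z, ‖∑ κ, T κ * ∏ j, toC (z (κ j))‖ ^ 2 ∂(complexGaussian s)
      = ‖((∫ z, ‖∑ κ, T κ * ∏ j, toC (z (κ j))‖ ^ 2 ∂(complexGaussian s) : ℝ) : ℂ)‖ := by
        rw [Complex.norm_real, Real.norm_of_nonneg hnn]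
    _ ≤ ∑ κ : J → ι, ∑ κ' : J → ι, (if mult κ = mult κ' then
          c / 2 * (‖T κ‖ ^ 2 * V κ) + c / 2 * (‖T κ'‖ ^ 2 * V κ') else 0) := by
        rw [hexp]
        exact norm_sum_le_of_le _ fun κ _ => norm_sum_le_of_le _ fun κ' _ => hterm κ κ'
    _ = ∑ κ, Finset.card {κ' : J → ι | mult κ = mult κ'} * (c * (‖T κ‖ ^ 2 * V κ)) := by
        simp only [ite_add_zero, Finset.sum_add_distrib]
        rw [hsymm]
        rw [← Finset.sum_add_distrib]
        refine Finset.sum_congr rfl fun κ _ => ?_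
        rw [← Finset.sum_filter, Finset.sum_const, nsmul_eq_mul]
        ring
    _ ≤ ∑ κ, ((Fintype.card J)! : ℝ) * (c * (‖T κ‖ ^ 2 * V κ)) := by
        refine Finset.sum_le_sum fun κ _ => mul_le_mul_of_nonneg_right
          (by exact_mod_cast card_mult_eq_le κ) ?_
        exact mul_nonneg hc0 (mul_nonneg (sq_nonneg _) (hV0 κ))
    _ = _ := by
        rw [Finset.mul_sum]
        refine Finset.sum_congr rfl fun κ _ => ?_
        rw [hc]; ring

theorem integrable_norm_sq_holomorphic [DecidableEq J] (T : (J → ι) → ℂ) :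
    Integrable (fun z => ‖∑ κ, T κ * ∏ j, toC (z (κ j))‖ ^ 2) (complexGaussian s) := by
  have h : Integrable (fun z : ι → ℝ × ℝ => ∑ κ, ∑ κ', T κ * conj (T κ')
      * ((∏ j, toC (z (κ j))) * conj (∏ j, toC (z (κ' j))))) (complexGaussian s) :=
    integrable_finsetSum _ fun κ _ => integrable_finsetSum _ fun κ' _ =>
      (integrable_monomial_mul_conj s κ κ').const_mul _
  simp_rw [← ofReal_norm_sq_holomorphic] at h
  exact h.re.congr (ae_of_all _ fun z => Complex.ofReal_re _)

end Multi

/-! ### Wick powers and holomorphic polynomials -/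

section Powers

variable {ι : Type*} [Fintype ι] (s : ι → ℝ≥0) {n : ℕ}

/-- The homogeneous polynomial of degree `n` with coefficient tensor `T`. -/
def tensorPoly (T : (Fin n → ι) → ℂ) (z : ι → ℝ × ℝ) : ℂ := ∑ κ, T κ * ∏ j, toC (z (κ j))

theorem continuous_tensorPoly (T : (Fin n → ι) → ℂ) : Continuous (tensorPoly T) := by
  have := continuous_toC
  unfold tensorPoly
  fun_prop

/-- The coefficient tensor of the `p`-th power of a homogeneous polynomial is the `p`-th tensor
power of its coefficient tensor. -/
theorem tensorPoly_pow (T : (Fin n → ι) → ℂ) (p : ℕ) (z : ι → ℝ × ℝ) :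
    tensorPoly T z ^ p
      = ∑ κ : Fin p × Fin n → ι, (∏ a, T fun j => κ (a, j)) * ∏ aj, toC (z (κ aj)) := by
  rw [tensorPoly, Fintype.sum_pow,
    ← (Equiv.curry (Fin p) (Fin n) ι).sum_comp fun K => ∏ a, T (K a) * ∏ j, toC (z (K a j))]
  refine Finset.sum_congr rfl fun κ _ => ?_
  rw [Finset.prod_mul_distrib, Fintype.prod_prod_type]
  rfl

theorem norm_tensorPoly_pow (T : (Fin n → ι) → ℂ) (p : ℕ) (z : ι → ℝ × ℝ) :
    ‖tensorPoly T z‖ ^ (2 * p) = ‖∑ κ : Fin p × Fin n → ι, (∏ a, T fun j => κ (a, j))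
      * ∏ aj, toC (z (κ aj))‖ ^ 2 := by
  rw [← tensorPoly_pow, norm_pow, ← pow_mul, mul_comm]

theorem integrable_norm_tensorPoly_pow [DecidableEq ι] (T : (Fin n → ι) → ℂ) (p : ℕ) :
    Integrable (fun z => ‖tensorPoly T z‖ ^ (2 * p)) (complexGaussian s) := by
  simp_rw [norm_tensorPoly_pow]
  exact integrable_norm_sq_holomorphic s _

/-- Moments of a homogeneous holomorphic polynomial: as its powers are again homogeneous
holomorphic polynomials, all moments are controlled by the second one. -/
theorem integral_norm_tensorPoly_pow_le [DecidableEq ι] (T : (Fin n → ι) → ℂ) (p : ℕ) :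
    ∫ z, ‖tensorPoly T z‖ ^ (2 * p) ∂(complexGaussian s)
      ≤ 16 ^ (p * n) * ((p * n)! : ℝ) ^ 3 * (∑ κ, ‖T κ‖ ^ 2 * ∏ j, (s (κ j) : ℝ)) ^ p := by
  simp_rw [norm_tensorPoly_pow]
  refine (integral_norm_sq_holomorphic_le s _).trans_eq ?_
  rw [Fintype.card_prod, Fintype.card_fin, Fintype.card_fin, Fintype.sum_pow,
    ← (Equiv.curry (Fin p) (Fin n) ι).sum_comp
      fun K => ∏ a, (‖T (K a)‖ ^ 2 * ∏ j, (s (K a j) : ℝ))]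
  congr 1
  refine Finset.sum_congr rfl fun κ _ => ?_
  rw [Finset.prod_mul_distrib, Fintype.prod_prod_type, norm_prod, ← Finset.prod_pow]
  rfl

end Powers

section Jensen

variable {ι : Type*} [Fintype ι] (s : ι → ℝ≥0) {n : ℕ}

/-- The law of independent centred real Gaussian variables. -/
abbrev realGaussian : Measure (ι → ℝ) := Measure.pi fun k => gaussianReal 0 (s k)

theorem measurePreserving_complexGaussian :
    MeasurePreserving (MeasurableEquiv.arrowProdEquivProdArrow ℝ ℝ ι)
      (complexGaussian s) ((realGaussian s).prod (realGaussian s)) :=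
  measurePreserving_arrowProdEquivProdArrow ℝ ℝ ι _ _

theorem integrable_prod_norm_tensorPoly_pow [DecidableEq ι] (T : (Fin n → ι) → ℂ) (p : ℕ) :
    Integrable (fun xy : (ι → ℝ) × (ι → ℝ) => ‖tensorPoly T fun k => (xy.1 k, xy.2 k)‖ ^ (2 * p))
      ((realGaussian s).prod (realGaussian s)) :=
  ((measurePreserving_complexGaussian s).integrable_comp_emb
    (MeasurableEquiv.measurableEmbedding _)).1 (integrable_norm_tensorPoly_pow s T p)

/-- Averaging a homogeneous holomorphic polynomial over the imaginary parts of its variables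
decreases even moments, by Jensen's inequality. -/
theorem integral_pow_average_le [DecidableEq ι] (T : (Fin n → ι) → ℂ) (D : (ι → ℝ) → ℝ)
    (hDm : AEStronglyMeasurable D (realGaussian s))
    (hD : ∀ x, (D x : ℂ) = ∫ y, tensorPoly T (fun k => (x k, y k)) ∂(realGaussian s)) (p : ℕ) :
    Integrable (fun x => D x ^ (2 * p)) (realGaussian s) ∧
      ∫ x, D x ^ (2 * p) ∂(realGaussian s)
        ≤ 16 ^ (p * n) * ((p * n)! : ℝ) ^ 3 * (∑ κ, ‖T κ‖ ^ 2 * ∏ j, (s (κ j) : ℝ)) ^ p := by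
  have hG := integrable_prod_norm_tensorPoly_pow s T p
  have hpt : ∀ᵐ x ∂(realGaussian s), D x ^ (2 * p)
      ≤ ∫ y, ‖tensorPoly T fun k => (x k, y k)‖ ^ (2 * p) ∂(realGaussian s) := by
    filter_upwards [hG.prod_right_ae, (integrable_prod_norm_tensorPoly_pow s T 1).prod_right_ae]
      with x hx hx1
    have hmeas : Continuous fun y : ι → ℝ => tensorPoly T fun k => (x k, y k) :=
      (continuous_tensorPoly T).comp (by fun_prop)
    have hint : Integrable (fun y : ι → ℝ => ‖tensorPoly T fun k => (x k, y k)‖)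
        (realGaussian s) := by
      refine ((integrable_const (1 : ℝ)).add hx1).mono' hmeas.norm.aestronglyMeasurable
        (ae_of_all _ fun y => ?_)
      simp only [norm_norm, Pi.add_apply, mul_one]
      nlinarith [sq_nonneg (‖tensorPoly T fun k => (x k, y k)‖ - 1)]
    calc D x ^ (2 * p) = ‖(D x : ℂ)‖ ^ (2 * p) := by
          rw [Complex.norm_real, Real.norm_eq_abs, (even_two_mul p).pow_abs]
      _ ≤ (∫ y, ‖tensorPoly T fun k => (x k, y k)‖ ∂(realGaussian s)) ^ (2 * p) := by
          rw [hD]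
          gcongr
          exact norm_integral_le_integral_norm _
      _ ≤ _ := (convexOn_pow (2 * p)).map_integral_le (continuous_pow _).continuousOn isClosed_Ici
          (ae_of_all _ fun y => norm_nonneg _) hint hx
  have hnn : ∀ x, 0 ≤ D x ^ (2 * p) := fun x => (even_two_mul p).pow_nonneg _
  refine ⟨hG.integral_prod_left.mono' (hDm.pow _) ?_, ?_⟩
  · filter_upwards [hpt] with x hx
    rwa [Real.norm_of_nonneg (hnn x)]
  · refine (integral_mono_of_nonneg (ae_of_all _ hnn) hG.integral_prod_left hpt).trans ?_
    rw [← integral_prod _ hG]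
    refine le_trans (le_of_eq ?_) (integral_norm_tensorPoly_pow_le s T p)
    exact ((measurePreserving_complexGaussian s).integral_comp'
      (fun xy : (ι → ℝ) × (ι → ℝ) => ‖tensorPoly T fun k => (xy.1 k, xy.2 k)‖ ^ (2 * p))).symm

end Jensen

section Wick

theorem integrable_pow_gaussianReal (v : ℝ≥0) (k : ℕ) :
    Integrable (fun y : ℝ => y ^ k) (gaussianReal 0 v) := by
  have := (memLp_id_gaussianReal' (μ := 0) (v := v) (k : ℝ≥0∞)
    (ENNReal.natCast_ne_top _)).integrable_norm_pow'
  refine this.mono' (by fun_prop) (ae_of_all _ fun x => ?_)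
  simp

theorem integral_odd_pow_gaussianReal (v : ℝ≥0) {k : ℕ} (hk : Odd k) :
    ∫ y, y ^ k ∂(gaussianReal 0 v) = 0 := by
  have h : ∫ y, y ^ k ∂(gaussianReal 0 v) = ∫ y, (-y) ^ k ∂(gaussianReal 0 v) := by
    have hm : gaussianReal 0 v = (gaussianReal 0 v).map (fun x => -x) := by
      rw [gaussianReal_map_neg, neg_zero]
    conv_lhs => rw [hm]
    rw [integral_map (by fun_prop) (by fun_prop)]
  simp_rw [hk.neg_pow, integral_neg] at h
  exact self_eq_neg.1 h

theorem integral_sq_gaussianReal (v : ℝ≥0) : ∫ y, y ^ 2 ∂(gaussianReal 0 v) = v := by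
  have h := variance_fun_id_gaussianReal (μ := 0) (v := v)
  rw [variance_eq_integral measurable_id'.aemeasurable] at h
  simpa using h

/-- The fourth moment follows from `E (X + i Y) ^ 4 = 0`, for independent `X` and `Y` of the
same centred Gaussian law. -/
theorem integral_pow_four_gaussianReal (v : ℝ≥0) :
    ∫ y, y ^ 4 ∂(gaussianReal 0 v) = 3 * v ^ 2 := by
  have h := integral_toC_monomial_of_ne v (show 4 ≠ 0 by norm_num)
  have hre : ∀ x : ℝ × ℝ, (toC x ^ 4 * conj (toC x) ^ 0).re
      = x.1 ^ 4 + x.2 ^ 4 - 6 * (x.1 ^ 2 * x.2 ^ 2) := by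
    intro x
    have : toC x ^ 4 * conj (toC x) ^ 0
        = ((x.1 ^ 4 + x.2 ^ 4 - 6 * (x.1 ^ 2 * x.2 ^ 2) : ℝ) : ℂ)
          + ((4 * x.1 ^ 3 * x.2 - 4 * x.1 * x.2 ^ 3 : ℝ) : ℂ) * Complex.I := by
      simp only [toC]
      push_cast
      ring_nf
      simp only [show Complex.I ^ 3 = -Complex.I by
        rw [pow_succ, Complex.I_sq]; ring, Complex.I_sq, Complex.I_pow_four]
      ring
    rw [this, Complex.add_re, Complex.ofReal_re, Complex.re_ofReal_mul, Complex.I_re]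
    ring
  have h4 := integrable_pow_gaussianReal v 4
  have h2 := integrable_pow_gaussianReal v 2
  have h' := congrArg Complex.re h
  rw [← RCLike.re_eq_complex_re, ← integral_re (integrable_toC_monomial v 4 0)] at h'
  simp only [RCLike.re_eq_complex_re, hre, Complex.zero_re] at h'
  have h44 : Integrable (fun x : ℝ × ℝ => x.1 ^ 4 + x.2 ^ 4) (planeGaussian v) :=
    (h4.comp_fst _).add (h4.comp_snd _)
  rw [integral_sub h44 ((h2.mul_prod h2).const_mul 6),
    integral_add (h4.comp_fst _) (h4.comp_snd _), integral_const_mul,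
    integral_prod_mul (fun x : ℝ => x ^ 2) (fun x : ℝ => x ^ 2),
    integral_fun_fst (fun x : ℝ => x ^ 4), integral_fun_snd (fun x : ℝ => x ^ 4)] at h'
  simp only [probReal_univ, one_smul, integral_sq_gaussianReal] at h'
  linarith

theorem eval_hermiteC_two (C a : ℝ) : (hermiteC C 2).eval a = a ^ 2 - C := by
  simp [hermiteC]; ring

theorem eval_hermiteC_three (C a : ℝ) : (hermiteC C 3).eval a = a ^ 3 - 3 * C * a := by
  simp [hermiteC]; ring

theorem eval_hermiteC_four (C a : ℝ) :
    (hermiteC C 4).eval a = a ^ 4 - 6 * C * a ^ 2 + 3 * C ^ 2 := by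
  simp [hermiteC]; ring

/-- Hermite polynomials are Gaussian averages of powers along the imaginary direction. -/
theorem integral_add_mul_I_pow (v : ℝ≥0) (a : ℝ) {n : ℕ} (hn : n = 2 ∨ n = 3 ∨ n = 4) :
    ∫ y : ℝ, ((a : ℂ) + y * Complex.I) ^ n ∂(gaussianReal 0 v)
      = ((hermiteC v n).eval a : ℝ) := by
  have hc : ∀ k : ℕ, ∫ y : ℝ, (y : ℂ) ^ k ∂(gaussianReal 0 v)
      = ((∫ y, y ^ k ∂(gaussianReal 0 v) : ℝ) : ℂ) := fun k => by
    rw [← integral_complex_ofReal]; simp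
  have hi : ∀ k : ℕ, Integrable (fun y : ℝ => (y : ℂ) ^ k) (gaussianReal 0 v) := fun k => by
    simpa using (integrable_pow_gaussianReal v k).ofReal (𝕜 := ℂ)
  have h3 := integral_odd_pow_gaussianReal v (show Odd 3 by decide)
  have hexp : ∫ y : ℝ, ((a : ℂ) + y * Complex.I) ^ n ∂(gaussianReal 0 v)
      = ∑ k ∈ Finset.range (n + 1), (a : ℂ) ^ k * Complex.I ^ (n - k) * n.choose k
        * ∫ y : ℝ, (y : ℂ) ^ (n - k) ∂(gaussianReal 0 v) := by
    simp_rw [← integral_const_mul]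
    rw [← integral_finsetSum _ fun k _ => (hi _).const_mul _]
    refine integral_congr_ae (ae_of_all _ fun y => ?_)
    simp only [add_pow, mul_pow]
    exact Finset.sum_congr rfl fun k _ => by ring
  rw [hexp]
  have hI3 : Complex.I ^ 3 = -Complex.I := by rw [pow_succ, Complex.I_sq]; ring
  rcases hn with rfl | rfl | rfl
  · simp only [Finset.sum_range_succ, Finset.sum_range_zero, hc, eval_hermiteC_two]
    simp [integral_sq_gaussianReal, Complex.I_sq]
    ring
  · simp only [Finset.sum_range_succ, Finset.sum_range_zero, hc, eval_hermiteC_three]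
    simp [h3, integral_sq_gaussianReal, Complex.I_sq, Nat.choose]
    ring
  · simp only [Finset.sum_range_succ, Finset.sum_range_zero, hc, eval_hermiteC_four]
    simp [h3, integral_sq_gaussianReal, integral_pow_four_gaussianReal, Complex.I_sq,
      Nat.choose]
    ring

variable {ι : Type*} [Fintype ι] (s : ι → ℝ≥0) {n : ℕ}

theorem map_linearForm_realGaussian (c : ι → ℝ) {C : ℝ≥0} (hC : ∑ k, c k ^ 2 * (s k : ℝ) = C) :
    (realGaussian s).map (fun y => ∑ k, c k * y k) = gaussianReal 0 C := by
  refine Measure.ext_of_charFun (funext fun t => ?_)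
  rw [charFun_gaussianReal, charFun_apply_real,
    integral_map (Continuous.aemeasurable (by fun_prop)) (by fun_prop)]
  have h : ∀ y : ι → ℝ, Complex.exp (t * ((∑ k, c k * y k : ℝ) : ℂ) * Complex.I)
      = ∏ k, Complex.exp (((t * c k : ℝ) : ℂ) * y k * Complex.I) := fun y => by
    rw [← Complex.exp_sum]
    congr 1
    push_cast
    rw [Finset.mul_sum, Finset.sum_mul]
    exact Finset.sum_congr rfl fun k _ => by ring
  simp_rw [h]
  rw [integral_fintype_prod_eq_prod
    (fun k (y : ℝ) => Complex.exp (((t * c k : ℝ) : ℂ) * y * Complex.I))]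
  simp_rw [← charFun_apply_real, charFun_gaussianReal]
  rw [← Complex.exp_sum]
  congr 1
  have hC' : (C : ℂ) = ∑ k, (c k : ℂ) ^ 2 * (s k : ℂ) := by
    have := congrArg (fun r : ℝ => (r : ℂ)) hC
    push_cast at this
    exact this.symm
  simp only [Complex.ofReal_zero, mul_zero, zero_mul, zero_sub]
  rw [hC', Finset.sum_mul, Finset.sum_div, ← Finset.sum_neg_distrib]
  refine Finset.sum_congr rfl fun k _ => ?_
  push_cast
  ring

theorem integrable_prod_toC [DecidableEq ι] (x : ι → ℝ) (κ : Fin n → ι) :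
    Integrable (fun y : ι → ℝ => ∏ j, toC (x (κ j), y (κ j))) (realGaussian s) := by
  simp_rw [fun y : ι → ℝ => prod_comp_eq_prod_pow_mult (fun k => toC (x k, y k)) κ]
  refine Integrable.fintype_prod (f := fun k (y : ℝ) => toC (x k, y) ^ mult κ k) fun k => ?_
  simp only [toC, add_pow, mul_pow]
  refine integrable_finsetSum _ fun m _ => Integrable.mul_const (Integrable.const_mul
    (Integrable.mul_const ?_ _) _) _
  simpa using (integrable_pow_gaussianReal (s k) (mult κ k - m)).ofReal (𝕜 := ℂ)

/-- The integral of the Wick power of a Gaussian field `ω ↦ ∑ k, x k * f k ω` is the average, over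
independent imaginary parts, of the integral of the ordinary power of the complexified field. -/
theorem integral_tensorPoly_eq [DecidableEq ι] {Ω : Type*} [MeasurableSpace Ω] (ν : Measure Ω)
    (f : ι → Ω → ℝ)
    (hf : ∀ κ : Fin n → ι, Integrable (fun ω => ∏ j, f (κ j) ω) ν) {C : ℝ}
    (hC : ∀ ω, ∑ k, f k ω ^ 2 * (s k : ℝ) = C) (hn : n = 2 ∨ n = 3 ∨ n = 4) (x : ι → ℝ) :
    ∫ y, tensorPoly (fun κ : Fin n → ι => ((∫ ω, ∏ j, f (κ j) ω ∂ν : ℝ) : ℂ))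
        (fun k => (x k, y k)) ∂(realGaussian s)
      = ((∫ ω, (hermiteC C n).eval (∑ k, x k * f k ω) ∂ν : ℝ) : ℂ) := by
  have hpt : ∀ ω, (((hermiteC C n).eval (∑ k, x k * f k ω) : ℝ) : ℂ)
      = ∑ κ : Fin n → ι, (∫ y, ∏ j, toC (x (κ j), y (κ j)) ∂(realGaussian s))
        * ((∏ j, f (κ j) ω : ℝ) : ℂ) := by
    intro ω
    have hC0 : 0 ≤ C := by
      rw [← hC ω]
      exact Finset.sum_nonneg fun k _ => mul_nonneg (sq_nonneg _) (s k).coe_nonneg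
    lift C to ℝ≥0 using hC0
    rw [← integral_add_mul_I_pow C _ hn, ← map_linearForm_realGaussian s (fun k => f k ω) (hC ω),
      integral_map (Continuous.aemeasurable (by fun_prop)) (by fun_prop)]
    simp_rw [← integral_mul_const]
    rw [← integral_finsetSum _ fun κ _ => (integrable_prod_toC s x κ).mul_const _]
    refine integral_congr_ae (ae_of_all _ fun y => ?_)
    have : ((∑ k, x k * f k ω : ℝ) : ℂ) + ((∑ k, f k ω * y k : ℝ) : ℂ) * Complex.I
        = ∑ k, toC (x k, y k) * (f k ω : ℂ) := by
      push_cast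
      rw [Finset.sum_mul, ← Finset.sum_add_distrib]
      refine Finset.sum_congr rfl fun k _ => ?_
      simp only [toC]
      ring
    simp only [this, Fintype.sum_pow, Finset.prod_mul_distrib, Complex.ofReal_prod]
  rw [← integral_complex_ofReal]
  simp_rw [hpt, tensorPoly]
  rw [integral_finsetSum _ fun κ _ => (integrable_prod_toC s x κ).const_mul _,
    integral_finsetSum _ fun κ _ => (hf κ).ofReal.const_mul _]
  refine Finset.sum_congr rfl fun κ _ => ?_
  rw [integral_const_mul, integral_const_mul, integral_complex_ofReal, mul_comm]

end Wick

/-! ### The Gaussian measure in real Fourier coordinates -/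

section Modes

theorem one_le_norm_mode {N : ℕ} (k : modes N) : 1 ≤ ‖k.1‖ := by
  have h := (mem_modes.1 k.2).1
  have h1 : (1 : ℤ) ≤ max |k.1.1| |k.1.2| := h
  have : ‖k.1‖ = ((max |k.1.1| |k.1.2| : ℤ) : ℝ) := by
    rw [Prod.norm_def, Int.norm_eq_abs, Int.norm_eq_abs]; push_cast; rfl
  rw [this]
  exact_mod_cast h1

theorem norm_mode_le {N : ℕ} (k : modes N) : ‖k.1‖ ≤ N := by
  have h := (mem_modes.1 k.2).2
  have : ‖k.1‖ = ((max |k.1.1| |k.1.2| : ℤ) : ℝ) := by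
    rw [Prod.norm_def, Int.norm_eq_abs, Int.norm_eq_abs]; push_cast; rfl
  rw [this]
  exact_mod_cast h

theorem norm_negMode {N : ℕ} (k : modes N) : ‖(negMode k).1‖ = ‖k.1‖ := norm_neg k.1

theorem eig_negMode {N : ℕ} (L : ℝ) (k : modes N) : eig L (negMode k).1 = eig L k.1 := by
  simp [eig, negMode]

theorem sum_comp_negMode {N : ℕ} {R : Type*} [AddCommMonoid R] (f : modes N → R) :
    ∑ k, f (negMode k) = ∑ k, f k :=
  Equiv.sum_comp (Function.Involutive.toPerm negMode negMode_negMode) f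

/-- The constant in the bound `1 / λ_k ≤ eigConst / |k|²`. -/
def eigConst (L : ℝ) : ℝ := 1 / ((2 * Real.pi / L) ^ 2 - 1)

variable {L : ℝ}

theorem one_lt_freq_sq (hL₀ : 0 < L) (hL : L < 2 * Real.pi) : 1 < (2 * Real.pi / L) ^ 2 :=
  one_lt_pow₀ ((one_lt_div hL₀).2 hL) two_ne_zero

theorem eigConst_pos (hL₀ : 0 < L) (hL : L < 2 * Real.pi) : 0 < eigConst L :=
  one_div_pos.2 (sub_pos.2 (one_lt_freq_sq hL₀ hL))

theorem le_eig (hL₀ : 0 < L) (hL : L < 2 * Real.pi) {N : ℕ} (k : modes N) :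
    ((2 * Real.pi / L) ^ 2 - 1) * ‖k.1‖ ^ 2 ≤ eig L k.1 := by
  have h1 := one_lt_freq_sq hL₀ hL
  have h2 := one_le_norm_mode k
  have h3 : ‖k.1‖ ^ 2 ≤ (k.1.1 : ℝ) ^ 2 + (k.1.2 : ℝ) ^ 2 := by
    rw [Prod.norm_def, Int.norm_eq_abs, Int.norm_eq_abs]
    rcases max_cases |(k.1.1 : ℝ)| |(k.1.2 : ℝ)| with h | h <;> rw [h.1, sq_abs] <;> nlinarith
  rw [eig]
  nlinarith

theorem eig_pos (hL₀ : 0 < L) (hL : L < 2 * Real.pi) {N : ℕ} (k : modes N) : 0 < eig L k.1 := by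
  have h1 := one_lt_freq_sq hL₀ hL
  have h2 := one_le_norm_mode k
  exact lt_of_lt_of_le (mul_pos (sub_pos.2 h1) (by positivity)) (le_eig hL₀ hL k)

/-- The variance `1 / λ_k` of the `k`-th coordinate. -/
def modeVar (L : ℝ) {N : ℕ} (k : modes N) : ℝ≥0 := (1 / eig L k.1).toNNReal

theorem coe_modeVar (hL₀ : 0 < L) (hL : L < 2 * Real.pi) {N : ℕ} (k : modes N) :
    (modeVar L k : ℝ) = 1 / eig L k.1 :=
  Real.coe_toNNReal _ (one_div_nonneg.2 (eig_pos hL₀ hL k).le)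

theorem coe_modeVar_le (hL₀ : 0 < L) (hL : L < 2 * Real.pi) {N : ℕ} (k : modes N) :
    (modeVar L k : ℝ) ≤ eigConst L * (‖k.1‖ ^ 2)⁻¹ := by
  have h2 := one_le_norm_mode k
  have h3 := sub_pos.2 (one_lt_freq_sq hL₀ hL)
  rw [coe_modeVar hL₀ hL, eigConst, one_div, one_div, ← mul_inv]
  exact inv_anti₀ (by positivity) (le_eig hL₀ hL k)

theorem norm_coeff_sq {N : ℕ} (v : modes N → ℝ) (k : modes N) :
    ‖coeff v k‖ ^ 2 = (v k ^ 2 + v (negMode k) ^ 2) / 2 := by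
  have h2 : ‖((√2 : ℝ) : ℂ)‖ ^ 2 = 2 := by
    rw [Complex.norm_real, Real.norm_eq_abs, sq_abs, Real.sq_sqrt zero_le_two]
  unfold coeff
  split_ifs
  · rw [norm_div, div_pow, h2, Complex.sq_norm, mul_comm Complex.I, Complex.normSq_add_mul_I]
  · rw [norm_div, div_pow, h2, Complex.sq_norm,
      show ((v (negMode k) : ℂ) - Complex.I * (v k : ℂ))
        = (v (negMode k) : ℂ) + ((-v k : ℝ) : ℂ) * Complex.I by push_cast; ring,
      Complex.normSq_add_mul_I]
    ring

theorem quadForm_eq (L : ℝ) {N : ℕ} (v : modes N → ℝ) :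
    quadForm L N v = ∑ k, eig L k.1 * v k ^ 2 / 2 := by
  have h : ∑ k : modes N, eig L k.1 * v (negMode k) ^ 2 = ∑ k : modes N, eig L k.1 * v k ^ 2 := by
    rw [← sum_comp_negMode]
    simp_rw [negMode_negMode, eig_negMode]
  simp_rw [quadForm, norm_coeff_sq, ← Finset.sum_div]
  simp_rw [mul_div_assoc', mul_add, ← Finset.sum_div, Finset.sum_add_distrib]
  rw [h]
  ring

/-- The Gaussian measure is the law of independent centred Gaussian coordinates. -/
theorem gaussPerp_eq (hL₀ : 0 < L) (hL : L < 2 * Real.pi) (N : ℕ) :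
    gaussPerp L N = realGaussian fun k : modes N => modeVar L k := by
  have hv : ∀ k : modes N, modeVar L k ≠ 0 := fun k =>
    (Real.toNNReal_pos.2 (one_div_pos.2 (eig_pos hL₀ hL k))).ne'
  have hdens : ∀ v : modes N → ℝ,
      Real.exp (-quadForm L N v) / ∏ k : modes N, √(2 * Real.pi / eig L k.1)
        = ∏ k, gaussianPDFReal 0 (modeVar L k) (v k) := by
    intro v
    simp_rw [gaussianPDFReal, coe_modeVar hL₀ hL]
    rw [Finset.prod_mul_distrib, ← Real.exp_sum, Finset.prod_inv_distrib, quadForm_eq,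
      ← Finset.sum_neg_distrib, div_eq_mul_inv, mul_comm (Real.exp _)]
    simp_rw [mul_one_div]
    congr 2
    refine Finset.sum_congr rfl fun k _ => ?_
    have := (eig_pos hL₀ hL k).ne'
    field_simp
    ring
  refine (Measure.pi_eq fun S hS => ?_).symm
  rw [gaussPerp, withDensity_apply _ (MeasurableSet.univ_pi hS), volume_pi,
    Measure.restrict_pi_pi]
  simp_rw [hdens]
  have hint : Integrable (fun v : modes N → ℝ => ∏ k, gaussianPDFReal 0 (modeVar L k) (v k))
      (Measure.pi fun k => volume.restrict (S k)) :=
    Integrable.fintype_prod (f := fun k (x : ℝ) => gaussianPDFReal 0 (modeVar L k) x)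
      fun k => (integrable_gaussianPDFReal 0 _).restrict
  rw [← ofReal_integral_eq_lintegral_ofReal hint (ae_of_all _ fun v =>
      Finset.prod_nonneg fun k _ => gaussianPDFReal_nonneg _ _ _),
    integral_fintype_prod_eq_prod (fun k (x : ℝ) => gaussianPDFReal 0 (modeVar L k) x),
    ENNReal.ofReal_prod_of_nonneg fun k _ => integral_nonneg fun x => gaussianPDFReal_nonneg _ _ _]
  exact Finset.prod_congr rfl fun k _ => (gaussianReal_apply_eq_integral 0 (hv k) (S k)).symm

end Modes

section Fourier

variable {L : ℝ}

theorem continuous_basisFun (k : ℤ × ℤ) : Continuous (basisFun L k) := by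
  unfold basisFun; fun_prop

theorem basisFun_neg (k : ℤ × ℤ) (x : Torus L) : basisFun L (-k) x = conj (basisFun L k x) := by
  simp only [map_mul, basisFun, Prod.fst_neg, Prod.snd_neg, fourier_neg, map_inv₀,
    Complex.conj_ofReal]

theorem norm_fourier_apply (n : ℤ) (x : AddCircle L) : ‖fourier n x‖ = 1 := by
  rw [fourier_apply]; exact Circle.norm_coe _

theorem norm_basisFun (hL₀ : 0 < L) (k : ℤ × ℤ) (x : Torus L) : ‖basisFun L k x‖ = L⁻¹ := by
  rw [basisFun, norm_mul, norm_mul, norm_fourier_apply, norm_fourier_apply, norm_inv,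
    Complex.norm_real, Real.norm_of_nonneg hL₀.le]
  simp

theorem prod_basisFun {n : ℕ} (K : Fin n → ℤ × ℤ) (x : Torus L) :
    ∏ i, basisFun L (K i) x
      = (L : ℂ)⁻¹ ^ n * (fourier (∑ i, K i).1 x.1 * fourier (∑ i, K i).2 x.2) := by
  induction n with
  | zero => simp
  | succ n ih =>
    rw [Fin.prod_univ_succ, ih, Fin.sum_univ_succ, basisFun, Prod.fst_add, Prod.snd_add,
      fourier_add, fourier_add]
    ring

theorem integral_fourier_eq_zero [hL : Fact (0 < L)] {n : ℤ} (hn : n ≠ 0) :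
    ∫ x : AddCircle L, fourier n x = 0 :=
  integral_eq_zero_of_add_right_eq_neg (fourier_add_half_inv_index hn hL.out)

theorem volume_real_torus [hL : Fact (0 < L)] :
    (volume : Measure (Torus L)).real Set.univ = L ^ 2 := by
  rw [measureReal_def, Measure.volume_eq_prod, ← Set.univ_prod_univ, Measure.prod_prod,
    AddCircle.measure_univ, ← ENNReal.ofReal_mul hL.out.le,
    ENNReal.toReal_ofReal (mul_self_nonneg L), sq]

theorem norm_integral_prod_basisFun_le [hL : Fact (0 < L)] {n : ℕ} (K : Fin n → ℤ × ℤ) :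
    ‖∫ x : Torus L, ∏ i, basisFun L (K i) x‖
      ≤ if ∑ i, K i = 0 then L⁻¹ ^ n * L ^ 2 else 0 := by
  split_ifs with h
  · refine (norm_integral_le_of_norm_le_const (C := L⁻¹ ^ n) (ae_of_all _ fun x => ?_)).trans ?_
    · rw [norm_prod]
      simp_rw [norm_basisFun hL.out]
      simp
    · rw [volume_real_torus]
  · simp_rw [prod_basisFun]
    rw [integral_const_mul, Measure.volume_eq_prod,
      integral_prod_mul (fun x : AddCircle L => fourier (∑ i, K i).1 x)
        (fun x : AddCircle L => fourier (∑ i, K i).2 x)]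
    have : (∑ i, K i).1 ≠ 0 ∨ (∑ i, K i).2 ≠ 0 := by
      by_contra! h'
      exact h (Prod.ext h'.1 h'.2)
    rcases this with h' | h' <;> rw [integral_fourier_eq_zero h'] <;> simp

/-- The real Fourier basis: `√2 Re e_k` for positive `k`, and `√2 Im e_k` otherwise. -/
def realMode (L : ℝ) (k : ℤ × ℤ) (x : Torus L) : ℝ :=
  √2 * if IsPositive k then (basisFun L k x).re else (basisFun L k x).im

theorem continuous_realMode (k : ℤ × ℤ) : Continuous (realMode L k) := by
  have := continuous_basisFun (L := L) k
  unfold realMode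
  split_ifs <;> fun_prop

theorem field_eq {N : ℕ} (v : modes N → ℝ) (x : Torus L) :
    field L N v x = ∑ k : modes N, v k * realMode L k.1 x := by
  set a : modes N → ℝ := fun k => if IsPositive k.1 then (basisFun L k.1 x).re / √2
    else (basisFun L k.1 x).im / √2 with ha
  have hre : ∀ k : modes N, (coeff v k * basisFun L k.1 x).re
      = a k * v k + a (negMode k) * v (negMode k) := by
    intro k
    have hneg : basisFun L (negMode k).1 x = conj (basisFun L k.1 x) := basisFun_neg k.1 x
    by_cases h : IsPositive k.1
    · have h' : ¬ IsPositive (negMode k).1 := fun h2 => (isPositive_negMode k).1 h2 h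
      simp only [ha, coeff, h, h', if_true, if_false, hneg, div_mul_eq_mul_div,
        Complex.div_ofReal_re]
      simp
      ring
    · have h' : IsPositive (negMode k).1 := (isPositive_negMode k).2 h
      simp only [ha, coeff, h, h', if_true, if_false, hneg, div_mul_eq_mul_div,
        Complex.div_ofReal_re]
      simp
      ring
  rw [field, Complex.re_sum]
  simp_rw [hre]
  rw [Finset.sum_add_distrib, sum_comp_negMode (fun k => a k * v k), ← Finset.sum_add_distrib]
  refine Finset.sum_congr rfl fun k _ => ?_
  have h2 : √2 ≠ 0 := by positivity
  have h3 : √2 ^ 2 = 2 := Real.sq_sqrt zero_le_two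
  simp only [ha, realMode]
  split_ifs <;> field_simp <;> rw [h3] <;> ring

theorem realMode_sq_add {N : ℕ} (hL₀ : 0 < L) (k : modes N) (x : Torus L) :
    realMode L k.1 x ^ 2 + realMode L (negMode k).1 x ^ 2 = 2 / L ^ 2 := by
  have hneg : basisFun L (negMode k).1 x = conj (basisFun L k.1 x) := basisFun_neg k.1 x
  have hn : (basisFun L k.1 x).re ^ 2 + (basisFun L k.1 x).im ^ 2 = (L ^ 2)⁻¹ := by
    rw [← inv_pow, ← norm_basisFun hL₀ k.1 x, Complex.sq_norm, Complex.normSq_apply]; ring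
  have h3 : √2 ^ 2 = 2 := Real.sq_sqrt zero_le_two
  by_cases h : IsPositive k.1
  · have h' : ¬ IsPositive (negMode k).1 := fun h2 => (isPositive_negMode k).1 h2 h
    simp only [realMode, h, h', if_true, if_false, hneg, mul_pow, h3, Complex.conj_im,
      div_eq_mul_inv, ← hn]
    ring
  · have h' : IsPositive (negMode k).1 := (isPositive_negMode k).2 h
    simp only [realMode, h, h', if_true, if_false, hneg, mul_pow, h3, Complex.conj_re,
      div_eq_mul_inv, ← hn]
    ring

/-- The wave vector `k` or `-k`, according to a choice of sign. -/
def signed (b : Bool) (k : ℤ × ℤ) : ℤ × ℤ := if b then k else -k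

theorem exists_realMode_eq (k : ℤ × ℤ) : ∃ a : Bool → ℂ, (∀ b, ‖a b‖ ≤ 1) ∧
    ∀ x : Torus L, (realMode L k x : ℂ) = ∑ b, a b * basisFun L (signed b k) x := by
  have h3 : ((√2 : ℝ) : ℂ) ^ 2 = 2 := by
    rw [← Complex.ofReal_pow, Real.sq_sqrt zero_le_two]; norm_num
  have hle : ‖((√2 : ℝ) : ℂ) / 2‖ ≤ 1 := by
    rw [norm_div, Complex.norm_real, Real.norm_of_nonneg (Real.sqrt_nonneg _)]
    have : √2 ≤ 2 := Real.sqrt_le_iff.2 ⟨by norm_num, by norm_num⟩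
    simp
    linarith
  by_cases h : IsPositive k
  · refine ⟨fun _ => (√2 : ℝ) / 2, fun _ => hle, fun x => ?_⟩
    simp only [Fintype.sum_bool, signed, if_true, Bool.false_eq_true, if_false, basisFun_neg,
      realMode, h]
    rw [← mul_add, Complex.add_conj]
    push_cast
    ring
  · refine ⟨fun b => if b then -Complex.I * ((√2 : ℝ) / 2) else Complex.I * ((√2 : ℝ) / 2),
      fun b => ?_, fun x => ?_⟩
    · cases b <;> simpa using hle
    · simp only [Fintype.sum_bool, signed, if_true, Bool.false_eq_true, if_false, basisFun_neg,
        realMode, h]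
      have := Complex.sub_conj (basisFun L k x)
      rw [show -Complex.I * (((√2 : ℝ) : ℂ) / 2) * basisFun L k x
          + Complex.I * (((√2 : ℝ) : ℂ) / 2) * conj (basisFun L k x)
        = -Complex.I * (((√2 : ℝ) : ℂ) / 2) * (basisFun L k x - conj (basisFun L k x)) by ring,
        this]
      push_cast
      linear_combination ((√2 : ℝ) : ℂ) * (basisFun L k x).im * Complex.I_mul_I

/-- Momentum conservation: the integral of a product of real modes vanishes unless some choice of
signs makes the wave vectors add up to zero. -/
theorem sq_integral_prod_realMode_le [hL : Fact (0 < L)] {n : ℕ} (K : Fin n → ℤ × ℤ) :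
    (∫ x : Torus L, ∏ i, realMode L (K i) x) ^ 2
      ≤ (L⁻¹ ^ n * L ^ 2) ^ 2 * 2 ^ n
        * ∑ b : Fin n → Bool, if ∑ i, signed (b i) (K i) = 0 then 1 else 0 := by
  choose a ha hak using fun i => exists_realMode_eq (L := L) (K i)
  set c : ℝ := L⁻¹ ^ n * L ^ 2 with hc
  set S : ℝ := ∑ b : Fin n → Bool, if ∑ i, signed (b i) (K i) = 0 then 1 else 0 with hS
  have hL₀ := hL.out
  have hS0 : 0 ≤ S := Finset.sum_nonneg fun b _ => by split_ifs <;> norm_num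
  have hSle : S ≤ 2 ^ n := by
    calc S ≤ ∑ b : Fin n → Bool, (1 : ℝ) := Finset.sum_le_sum fun b _ => by
          split_ifs <;> norm_num
      _ = 2 ^ n := by simp
  have hexp : ((∫ x : Torus L, ∏ i, realMode L (K i) x : ℝ) : ℂ)
      = ∑ b : Fin n → Bool, (∏ i, a i (b i))
        * ∫ x : Torus L, ∏ i, basisFun L (signed (b i) (K i)) x := by
    rw [← integral_complex_ofReal]
    simp_rw [← integral_const_mul]
    rw [← integral_finsetSum _ fun b _ => ?_]
    · refine integral_congr_ae (ae_of_all _ fun x => ?_)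
      simp only [Complex.ofReal_prod, hak, Fintype.prod_sum, Finset.prod_mul_distrib]
    · have := fun k => continuous_basisFun (L := L) k
      exact Continuous.integrable_of_hasCompactSupport (by fun_prop)
        (HasCompactSupport.of_compactSpace _)
  have hle : |∫ x : Torus L, ∏ i, realMode L (K i) x| ≤ c * S := by
    rw [← Real.norm_eq_abs, ← Complex.norm_real, hexp, hS, Finset.mul_sum]
    refine norm_sum_le_of_le _ fun b _ => ?_
    rw [norm_mul, norm_prod]
    calc (∏ i, ‖a i (b i)‖) * ‖∫ x : Torus L, ∏ i, basisFun L (signed (b i) (K i)) x‖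
        ≤ 1 * (if ∑ i, signed (b i) (K i) = 0 then c else 0) := by
          gcongr
          · exact Finset.prod_le_one (fun _ _ => norm_nonneg _) fun i _ => ha i _
          · exact norm_integral_prod_basisFun_le _
      _ = _ := by split_ifs <;> simp
  calc (∫ x : Torus L, ∏ i, realMode L (K i) x) ^ 2 ≤ (c * S) ^ 2 := by
        rw [← sq_abs]; gcongr
    _ = c ^ 2 * S * S := by ring
    _ ≤ c ^ 2 * 2 ^ n * S := by gcongr

end Fourier

/-! ### Lattice sums -/

section Lattice

theorem summable_norm_rpow_int_prod {r : ℝ} (hr : 2 < r) :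
    Summable fun k : ℤ × ℤ => ‖k‖ ^ (-r) := by
  have h := EisensteinSeries.summable_one_div_norm_rpow hr
  rw [← (finTwoArrowEquiv ℤ).symm.summable_iff] at h
  refine h.congr fun k => ?_
  rw [Function.comp_apply]
  have : ‖(finTwoArrowEquiv ℤ).symm k‖ = ‖k‖ := by
    simp [EisensteinSeries.norm_eq_max_natAbs, Prod.norm_def, Int.norm_eq_abs, Nat.cast_max,
      Nat.cast_natAbs]
  rw [this]

/-- The sum of `|k| ^ (-5/2)` over the lattice. -/
def latticeConst : ℝ := ∑' k : ℤ × ℤ, ‖k‖ ^ (-(5 / 2) : ℝ)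

theorem latticeConst_nonneg : 0 ≤ latticeConst :=
  tsum_nonneg fun _ => Real.rpow_nonneg (norm_nonneg _) _

theorem sum_modes_le_latticeConst (N : ℕ) :
    ∑ k : modes N, ‖k.1‖ ^ (-(5 / 2) : ℝ) ≤ latticeConst := by
  rw [Finset.sum_coe_sort (modes N) fun k => ‖k‖ ^ (-(5 / 2) : ℝ)]
  exact (summable_norm_rpow_int_prod (by norm_num)).sum_le_tsum _
    fun _ _ => Real.rpow_nonneg (norm_nonneg _) _

theorem rpow_neg_half_pow {r : ℝ} (hr : 0 < r) (n : ℕ) :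
    (r ^ (-(1 / 2) : ℝ)) ^ n = r ^ (-(n / 2) : ℝ) := by
  rw [← Real.rpow_natCast, ← Real.rpow_mul hr.le]
  congr 1
  ring

/-- If the factor `x j` is the smallest one, three quarters of `x j ^ 4` can be distributed to the
other factors. -/
theorem prod_pow_four_le {m : ℕ} (hm : m ≤ 3) {x : Fin (m + 1) → ℝ} (h0 : ∀ i, 0 ≤ x i)
    (h1 : ∀ i, x i ≤ 1) {j : Fin (m + 1)} (hj : ∀ i, x j ≤ x i) {δ : ℝ} (hδ : x j ≤ δ) :
    ∏ i, x i ^ 4 ≤ δ * ∏ i, x (j.succAbove i) ^ 5 := by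
  simp_rw [pow_succ' _ 4]
  rw [Fin.prod_univ_succAbove _ j, Finset.prod_mul_distrib, ← mul_assoc]
  refine mul_le_mul_of_nonneg_right ?_ (Finset.prod_nonneg fun i _ => pow_nonneg (h0 _) _)
  have hδ0 : 0 ≤ δ := (h0 j).trans hδ
  calc x j ^ 4 = x j * x j ^ 3 := pow_succ' _ _
    _ ≤ δ * x j ^ m := mul_le_mul hδ (pow_le_pow_of_le_one (h0 _) (h1 _) hm)
          (pow_nonneg (h0 _) _) hδ0
    _ ≤ δ * ∏ i, x (j.succAbove i) := by
        refine mul_le_mul_of_nonneg_left ?_ hδ0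
        rw [← Fin.prod_const]
        exact Finset.prod_le_prod (fun _ _ => h0 _) fun i _ => hj _

theorem inv_sq_eq_rpow_pow {r : ℝ} (hr : 0 < r) : (r ^ 2)⁻¹ = (r ^ (-(1 / 2) : ℝ)) ^ 4 := by
  rw [rpow_neg_half_pow hr, ← Real.rpow_natCast, ← Real.rpow_neg hr.le]
  norm_num

theorem rpow_five_halves_eq {r : ℝ} (hr : 0 < r) :
    r ^ (-(5 / 2) : ℝ) = (r ^ (-(1 / 2) : ℝ)) ^ 5 := by
  rw [rpow_neg_half_pow hr]
  norm_num

/-- Giving the weight `|κ_j| ^ (-2)` of the largest wave vector to the others, each of them keeps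
the summable weight `|κ_i| ^ (-5/2)`, and a factor `M ^ (-1/2)` remains. -/
theorem prod_inv_sq_le {N m M : ℕ} (hm : m ≤ 3) (hM : 1 ≤ M) (κ : Fin (m + 1) → modes N)
    (hκ : ∃ j, (M : ℝ) < ‖(κ j).1‖) :
    ∏ i, (‖(κ i).1‖ ^ 2)⁻¹
      ≤ ∑ j : Fin (m + 1),
        (M : ℝ) ^ (-(1 / 2) : ℝ) * ∏ i, ‖(κ (j.succAbove i)).1‖ ^ (-(5 / 2) : ℝ) := by
  have hpos : ∀ k : modes N, 0 < ‖k.1‖ := fun k => one_pos.trans_le (one_le_norm_mode k)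
  have hanti : ∀ {a b : ℝ}, 0 < a → a ≤ b → b ^ (-(1 / 2) : ℝ) ≤ a ^ (-(1 / 2) : ℝ) :=
    fun ha hab => Real.rpow_le_rpow_of_nonpos ha hab (by norm_num)
  obtain ⟨j, -, hj⟩ := Finset.exists_max_image Finset.univ (fun i => ‖(κ i).1‖)
    (Finset.univ_nonempty)
  have hjM : (M : ℝ) ≤ ‖(κ j).1‖ := by
    obtain ⟨i, hi⟩ := hκ
    exact hi.le.trans (hj i (Finset.mem_univ _))
  have hM0 : (0 : ℝ) < M := by exact_mod_cast hM
  have hmain := prod_pow_four_le hm (x := fun i => ‖(κ i).1‖ ^ (-(1 / 2) : ℝ))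
    (fun i => Real.rpow_nonneg (norm_nonneg _) _)
    (fun i => Real.rpow_le_one_of_one_le_of_nonpos (one_le_norm_mode _) (by norm_num))
    (fun i => hanti (hpos _) (hj i (Finset.mem_univ _))) (hanti hM0 hjM)
  calc ∏ i, (‖(κ i).1‖ ^ 2)⁻¹ = ∏ i, (‖(κ i).1‖ ^ (-(1 / 2) : ℝ)) ^ 4 :=
        Finset.prod_congr rfl fun i _ => inv_sq_eq_rpow_pow (hpos _)
    _ ≤ (M : ℝ) ^ (-(1 / 2) : ℝ)
        * ∏ i, (‖(κ (j.succAbove i)).1‖ ^ (-(1 / 2) : ℝ)) ^ 5 := hmain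
    _ = (M : ℝ) ^ (-(1 / 2) : ℝ) * ∏ i, ‖(κ (j.succAbove i)).1‖ ^ (-(5 / 2) : ℝ) := by
        congr 1
        exact Finset.prod_congr rfl fun i _ => (rpow_five_halves_eq (hpos _)).symm
    _ ≤ _ := by
        refine Finset.single_le_sum (f := fun j : Fin (m + 1) => (M : ℝ) ^ (-(1 / 2) : ℝ)
          * ∏ i, ‖(κ (j.succAbove i)).1‖ ^ (-(5 / 2) : ℝ)) (fun j _ => ?_) (Finset.mem_univ j)
        exact mul_nonneg (Real.rpow_nonneg hM0.le _) (Finset.prod_nonneg fun i _ =>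
          Real.rpow_nonneg (norm_nonneg _) _)

theorem signed_injective (b : Bool) : Function.Injective (signed b) := by
  cases b
  · exact neg_injective
  · exact fun _ _ h => h

theorem sum_momentum_le {N m : ℕ} (b : Fin (m + 1) → Bool) (j : Fin (m + 1)) (g : modes N → ℝ)
    (hg : ∀ k, 0 ≤ g k) :
    ∑ κ : Fin (m + 1) → modes N with ∑ i, signed (b i) (κ i).1 = 0, ∏ i, g (κ (j.succAbove i))
      ≤ (∑ k, g k) ^ m := by
  rw [Fintype.sum_pow]
  have hinj : Set.InjOn (fun κ : Fin (m + 1) → modes N => fun i => κ (j.succAbove i))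
      (Finset.univ.filter fun κ : Fin (m + 1) → modes N =>
        ∑ i, signed (b i) (κ i).1 = 0 : Finset (Fin (m + 1) → modes N)) := by
    intro κ hκ κ' hκ' he
    simp only [Finset.coe_filter, Finset.mem_univ, true_and, Set.mem_ofPred_eq] at hκ hκ'
    have he' : ∀ i, κ (j.succAbove i) = κ' (j.succAbove i) := fun i => congrFun he i
    rw [Fin.sum_univ_succAbove _ j] at hκ hκ'
    simp only [he'] at hκ
    have hj := signed_injective (b j) (add_right_cancel (hκ.trans hκ'.symm))
    funext i
    rcases Fin.eq_self_or_eq_succAbove j i with rfl | ⟨l, rfl⟩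
    · exact Subtype.ext hj
    · exact he' l
  rw [← Finset.sum_image (f := fun K : Fin m → modes N => ∏ i, g (K i)) hinj]
  exact Finset.sum_le_sum_of_subset_of_nonneg (Finset.subset_univ _)
    fun K _ _ => Finset.prod_nonneg fun i _ => hg _

theorem sum_inv_sq_momentum_le {N m M : ℕ} (hm : m ≤ 3) (hM : 1 ≤ M) (b : Fin (m + 1) → Bool) :
    ∑ κ : Fin (m + 1) → modes N with ∃ j, (M : ℝ) < ‖(κ j).1‖,
        (if ∑ i, signed (b i) (κ i).1 = 0 then 1 else 0) * ∏ i, (‖(κ i).1‖ ^ 2)⁻¹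
      ≤ (m + 1) * latticeConst ^ m * (M : ℝ) ^ (-(1 / 2) : ℝ) := by
  have hM0 : (0 : ℝ) ≤ (M : ℝ) ^ (-(1 / 2) : ℝ) := Real.rpow_nonneg (Nat.cast_nonneg _) _
  have hg : ∀ k : modes N, 0 ≤ ‖k.1‖ ^ (-(5 / 2) : ℝ) := fun k =>
    Real.rpow_nonneg (norm_nonneg _) _
  calc ∑ κ : Fin (m + 1) → modes N with ∃ j, (M : ℝ) < ‖(κ j).1‖,
        (if ∑ i, signed (b i) (κ i).1 = 0 then 1 else 0) * ∏ i, (‖(κ i).1‖ ^ 2)⁻¹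
      ≤ ∑ κ : Fin (m + 1) → modes N, (if ∑ i, signed (b i) (κ i).1 = 0 then 1 else 0)
          * ∑ j : Fin (m + 1), (M : ℝ) ^ (-(1 / 2) : ℝ)
            * ∏ i, ‖(κ (j.succAbove i)).1‖ ^ (-(5 / 2) : ℝ) := by
        have hnn : ∀ κ : Fin (m + 1) → modes N,
            0 ≤ ∑ j : Fin (m + 1), (M : ℝ) ^ (-(1 / 2) : ℝ)
              * ∏ i, ‖(κ (j.succAbove i)).1‖ ^ (-(5 / 2) : ℝ) := fun κ =>
          Finset.sum_nonneg fun j _ => mul_nonneg hM0 (Finset.prod_nonneg fun i _ => hg _)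
        have hite : ∀ κ : Fin (m + 1) → modes N,
            (0 : ℝ) ≤ if ∑ i, signed (b i) (κ i).1 = 0 then 1 else 0 := fun κ => by
          split_ifs <;> norm_num
        refine (Finset.sum_le_sum fun κ hκ => mul_le_mul_of_nonneg_left (prod_inv_sq_le hm hM κ
          (Finset.mem_filter.1 hκ).2) (hite κ)).trans ?_
        exact Finset.sum_le_sum_of_subset_of_nonneg (Finset.filter_subset _ _)
          fun κ _ _ => mul_nonneg (hite κ) (hnn κ)
    _ = ∑ j : Fin (m + 1), (M : ℝ) ^ (-(1 / 2) : ℝ)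
          * ∑ κ : Fin (m + 1) → modes N with ∑ i, signed (b i) (κ i).1 = 0,
            ∏ i, ‖(κ (j.succAbove i)).1‖ ^ (-(5 / 2) : ℝ) := by
        simp_rw [Finset.mul_sum, Finset.sum_filter]
        rw [Finset.sum_comm]
        refine Finset.sum_congr rfl fun j _ => Finset.sum_congr rfl fun κ _ => ?_
        split_ifs <;> simp
    _ ≤ ∑ j : Fin (m + 1), (M : ℝ) ^ (-(1 / 2) : ℝ) * latticeConst ^ m := by
        refine Finset.sum_le_sum fun j _ => mul_le_mul_of_nonneg_left ?_ hM0
        refine (sum_momentum_le b j (fun k => ‖k.1‖ ^ (-(5 / 2) : ℝ)) hg).trans ?_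
        exact pow_le_pow_left₀ (Finset.sum_nonneg fun k _ => hg k) (sum_modes_le_latticeConst N) m
    _ = _ := by simp; ring

/-- The logarithmic divergence of the Green function on the diagonal. -/
theorem sum_inv_sq_modes_le (N M : ℕ) :
    ∑ k : modes N with ‖k.1‖ ≤ M, (‖k.1‖ ^ 2)⁻¹ ≤ 8 * (1 + Real.log M) := by
  set size : modes N → ℕ := fun k => max k.1.1.natAbs k.1.2.natAbs with hsize
  have hnorm : ∀ k : modes N, ‖k.1‖ = size k := fun k => by
    simp [hsize, Prod.norm_def, Int.norm_eq_abs, Nat.cast_max, Nat.cast_natAbs]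
  have hmaps : ∀ k ∈ (Finset.univ.filter fun k : modes N => ‖k.1‖ ≤ M),
      size k ∈ Finset.Icc 1 M := fun k hk => by
    have h1 := one_le_norm_mode k
    have h2 := (Finset.mem_filter.1 hk).2
    rw [hnorm] at h1 h2
    exact Finset.mem_Icc.2 ⟨by exact_mod_cast h1, by exact_mod_cast h2⟩
  rw [← Finset.sum_fiberwise_of_maps_to hmaps]
  have hinner : ∀ r ∈ Finset.Icc 1 M,
      ∑ k ∈ (Finset.univ.filter fun k : modes N => ‖k.1‖ ≤ M) with size k = r, (‖k.1‖ ^ 2)⁻¹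
        ≤ 8 * (r : ℝ)⁻¹ := fun r hr => by
    have hr0 : r ≠ 0 := by have := (Finset.mem_Icc.1 hr).1; omega
    have hr0' : (r : ℝ) ≠ 0 := by exact_mod_cast hr0
    have hcard : Finset.card {k ∈ (Finset.univ.filter fun k : modes N => ‖k.1‖ ≤ M) | size k = r}
        ≤ 8 * r := by
      rw [← Int.card_box hr0]
      refine Finset.card_le_card_of_injOn (fun k => k.1) (fun k hk => ?_)
        Subtype.val_injective.injOn
      exact Int.mem_box.2 (Finset.mem_filter.1 hk).2
    calc _ = ∑ k ∈ (Finset.univ.filter fun k : modes N => ‖k.1‖ ≤ M) with size k = r,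
          ((r : ℝ) ^ 2)⁻¹ := Finset.sum_congr rfl fun k hk => by
            rw [hnorm, (Finset.mem_filter.1 hk).2]
      _ ≤ ((8 * r : ℕ) : ℝ) * ((r : ℝ) ^ 2)⁻¹ := by
          rw [Finset.sum_const, nsmul_eq_mul]
          gcongr
      _ = 8 * (r : ℝ)⁻¹ := by push_cast; field_simp
  refine (Finset.sum_le_sum hinner).trans ?_
  rw [← Finset.mul_sum]
  have := harmonic_le_one_add_log M
  rw [harmonic_eq_sum_Icc] at this
  push_cast at this
  linarith

end Lattice

/-! ### Truncated fields -/

section Truncation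

/-- The real Fourier basis with the wave vectors `|k| > M` removed. Truncating in this way, rather
than by passing from `modes N` to `modes M`, keeps all fields on one probability space. -/
def truncMode (L : ℝ) (M : ℕ) (k : ℤ × ℤ) (x : Torus L) : ℝ :=
  if ‖k‖ ≤ M then realMode L k x else 0

/-- The renormalisation constant of the truncated field. -/
def truncConst (L : ℝ) (N M : ℕ) : ℝ := 1 / L ^ 2 * ∑ k : modes N with ‖k.1‖ ≤ M, 1 / eig L k.1

/-- The integrated Wick power of the truncated field. -/
def truncWick (L : ℝ) [Fact (0 < L)] (N M n : ℕ) (v : modes N → ℝ) : ℝ :=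
  ∫ x : Torus L, (hermiteC (truncConst L N M) n).eval (∑ k, v k * truncMode L M k.1 x)

/-- The interaction of the truncated field. -/
def truncInteraction (L : ℝ) [Fact (0 < L)] (N M : ℕ) (μ ε z₀ : ℝ) (v : modes N → ℝ) : ℝ :=
  3 * z₀ ^ 2 / (2 * L ^ 2) * truncWick L N M 2 v
    + μ * (-(3 * ε / (2 * L ^ 2)) * truncWick L N M 2 v + z₀ / L * √ε * truncWick L N M 3 v
      + 1 / 4 * ε * truncWick L N M 4 v)

variable {L : ℝ}

theorem continuous_truncMode (M : ℕ) (k : ℤ × ℤ) : Continuous (truncMode L M k) := by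
  unfold truncMode
  split_ifs
  · exact continuous_realMode k
  · exact continuous_const

theorem truncMode_of_le {N M : ℕ} (h : N ≤ M) (k : modes N) :
    truncMode L M k.1 = realMode L k.1 := by
  have : ‖k.1‖ ≤ M := (norm_mode_le k).trans (by exact_mod_cast h)
  funext x
  simp [truncMode, this]

theorem truncConst_of_le {N M : ℕ} (h : N ≤ M) : truncConst L N M = renormConst L N := by
  have : ∀ k : modes N, ‖k.1‖ ≤ M := fun k => (norm_mode_le k).trans (by exact_mod_cast h)
  simp [truncConst, renormConst, this]

theorem truncWick_of_le [Fact (0 < L)] {N M : ℕ} (h : N ≤ M) (n : ℕ) (v : modes N → ℝ) :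
    truncWick L N M n v = wickInt L N n v := by
  simp only [truncWick, wickInt, truncConst_of_le h, truncMode_of_le h, field_eq]

theorem truncInteraction_of_le [Fact (0 < L)] {N M : ℕ} (h : N ≤ M) (μ ε z₀ : ℝ)
    (v : modes N → ℝ) : truncInteraction L N M μ ε z₀ v = interaction L N μ ε z₀ v := by
  simp only [truncInteraction, interaction, truncWick_of_le h]

theorem sum_truncMode_sq (hL₀ : 0 < L) (hL : L < 2 * Real.pi) (N M : ℕ) (x : Torus L) :
    ∑ k : modes N, truncMode L M k.1 x ^ 2 * (modeVar L k : ℝ) = truncConst L N M := by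
  set g : modes N → ℝ := fun k => truncMode L M k.1 x ^ 2 * (modeVar L k : ℝ) with hg
  have hpair : ∀ k : modes N, g k + g (negMode k)
      = if ‖k.1‖ ≤ M then 2 / L ^ 2 * (1 / eig L k.1) else 0 := by
    intro k
    simp only [hg, truncMode, coe_modeVar hL₀ hL, norm_negMode, eig_negMode]
    split_ifs
    · rw [← add_mul, realMode_sq_add hL₀]
    · simp
  have hsum : 2 * ∑ k, g k = ∑ k, (g k + g (negMode k)) := by
    rw [Finset.sum_add_distrib, sum_comp_negMode, two_mul]
  simp_rw [hpair] at hsum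
  rw [← Finset.sum_filter, ← Finset.mul_sum] at hsum
  rw [truncConst]
  linear_combination hsum / 2

theorem truncConst_nonneg (hL₀ : 0 < L) (hL : L < 2 * Real.pi) (N M : ℕ) :
    0 ≤ truncConst L N M :=
  mul_nonneg (by positivity) (Finset.sum_nonneg fun k _ => one_div_nonneg.2 (eig_pos hL₀ hL k).le)

theorem truncConst_le (hL₀ : 0 < L) (hL : L < 2 * Real.pi) (N M : ℕ) :
    truncConst L N M ≤ 8 * eigConst L / L ^ 2 * (1 + Real.log M) := by
  have hA := eigConst_pos hL₀ hL
  calc truncConst L N M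
      ≤ 1 / L ^ 2 * ∑ k : modes N with ‖k.1‖ ≤ M, eigConst L * (‖k.1‖ ^ 2)⁻¹ := by
        unfold truncConst
        gcongr with k
        rw [← coe_modeVar hL₀ hL]
        exact coe_modeVar_le hL₀ hL k
    _ ≤ 1 / L ^ 2 * (eigConst L * (8 * (1 + Real.log M))) := by
        rw [← Finset.mul_sum]
        gcongr
        exact sum_inv_sq_modes_le N M
    _ = _ := by ring

variable [Fact (0 < L)]

theorem stronglyMeasurable_truncWick (N M n : ℕ) :
    StronglyMeasurable (truncWick L N M n : (modes N → ℝ) → ℝ) := by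
  have h : Continuous fun vx : (modes N → ℝ) × Torus L =>
      (hermiteC (truncConst L N M) n).eval (∑ k, vx.1 k * truncMode L M k.1 vx.2) := by
    have := continuous_truncMode (L := L) M
    exact (hermiteC (truncConst L N M) n).continuous.comp (by fun_prop)
  exact h.stronglyMeasurable.integral_prod_right

theorem integrable_hermite_truncMode (N M n : ℕ) (v : modes N → ℝ) :
    Integrable fun x : Torus L =>
      (hermiteC (truncConst L N M) n).eval (∑ k, v k * truncMode L M k.1 x) := by
  have := continuous_truncMode (L := L) M
  exact Continuous.integrable_of_hasCompactSupport
    ((hermiteC (truncConst L N M) n).continuous.comp (by fun_prop))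
    (HasCompactSupport.of_compactSpace _)

theorem integrable_prod_truncMode {N n : ℕ} (M : ℕ) (κ : Fin n → modes N) :
    Integrable fun x : Torus L => ∏ j, truncMode L M (κ j).1 x := by
  have := continuous_truncMode (L := L) M
  exact Continuous.integrable_of_hasCompactSupport (by fun_prop)
    (HasCompactSupport.of_compactSpace _)

/-- The coefficient tensor of the difference between the integrated powers of the field and of the
truncated field. -/
def diffTensor (L : ℝ) [Fact (0 < L)] {N n : ℕ} (M : ℕ) (κ : Fin n → modes N) : ℝ :=
  (∫ x : Torus L, ∏ j, realMode L (κ j).1 x) - ∫ x : Torus L, ∏ j, truncMode L M (κ j).1 x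

theorem diffTensor_sq_le {N n : ℕ} (M : ℕ) (κ : Fin n → modes N) :
    diffTensor L M κ ^ 2 ≤ if ∃ j, (M : ℝ) < ‖(κ j).1‖ then (L⁻¹ ^ n * L ^ 2) ^ 2 * 2 ^ n
        * ∑ b : Fin n → Bool, (if ∑ i, signed (b i) (κ i).1 = 0 then 1 else 0) else 0 := by
  split_ifs with h
  · obtain ⟨j, hj⟩ := h
    have h0 : ∀ x : Torus L, ∏ j, truncMode L M (κ j).1 x = 0 := fun x =>
      Finset.prod_eq_zero (Finset.mem_univ j) (by simp [truncMode, not_le.2 hj])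
    simp only [diffTensor, h0, integral_zero, sub_zero]
    exact sq_integral_prod_realMode_le _
  · push Not at h
    simp [diffTensor, truncMode, h]

theorem sum_diffTensor_sq_le (hL : L < 2 * Real.pi) {N m M : ℕ} (hm : m ≤ 3) (hM : 1 ≤ M) :
    ∑ κ : Fin (m + 1) → modes N, diffTensor L M κ ^ 2 * ∏ j, (modeVar L (κ j) : ℝ)
      ≤ (L⁻¹ ^ (m + 1) * L ^ 2) ^ 2 * 2 ^ (m + 1) * eigConst L ^ (m + 1) * 2 ^ (m + 1)
        * ((m + 1) * latticeConst ^ m) * (M : ℝ) ^ (-(1 / 2) : ℝ) := by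
  have hL₀ : 0 < L := Fact.out
  have hA := eigConst_pos hL₀ hL
  set c : ℝ := (L⁻¹ ^ (m + 1) * L ^ 2) ^ 2 * 2 ^ (m + 1) with hc
  have hc0 : 0 ≤ c := by positivity
  have hprod : ∀ κ : Fin (m + 1) → modes N, ∏ j, (modeVar L (κ j) : ℝ)
      ≤ eigConst L ^ (m + 1) * ∏ j, (‖(κ j).1‖ ^ 2)⁻¹ := fun κ => by
    rw [← Fin.prod_const, ← Finset.prod_mul_distrib]
    exact Finset.prod_le_prod (fun _ _ => NNReal.coe_nonneg _)
      fun j _ => coe_modeVar_le hL₀ hL (κ j)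
  calc ∑ κ : Fin (m + 1) → modes N, diffTensor L M κ ^ 2 * ∏ j, (modeVar L (κ j) : ℝ)
      ≤ ∑ κ : Fin (m + 1) → modes N, (if ∃ j, (M : ℝ) < ‖(κ j).1‖ then
          c * ∑ b : Fin (m + 1) → Bool, (if ∑ i, signed (b i) (κ i).1 = 0 then 1 else 0) else 0)
          * (eigConst L ^ (m + 1) * ∏ j, (‖(κ j).1‖ ^ 2)⁻¹) := by
        refine Finset.sum_le_sum fun κ _ => mul_le_mul (diffTensor_sq_le M κ) (hprod κ)
          (Finset.prod_nonneg fun _ _ => NNReal.coe_nonneg _)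
          ((sq_nonneg _).trans (diffTensor_sq_le M κ))
    _ = c * eigConst L ^ (m + 1) * ∑ b : Fin (m + 1) → Bool,
          ∑ κ : Fin (m + 1) → modes N with ∃ j, (M : ℝ) < ‖(κ j).1‖,
            (if ∑ i, signed (b i) (κ i).1 = 0 then 1 else 0) * ∏ i, (‖(κ i).1‖ ^ 2)⁻¹ := by
        rw [Finset.sum_comm, Finset.sum_filter, Finset.mul_sum]
        refine Finset.sum_congr rfl fun κ _ => ?_
        split_ifs
        · rw [← Finset.sum_mul]
          ring
        · simp
    _ ≤ c * eigConst L ^ (m + 1) * ∑ b : Fin (m + 1) → Bool,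
          (m + 1) * latticeConst ^ m * (M : ℝ) ^ (-(1 / 2) : ℝ) := by
        gcongr with b
        exact sum_inv_sq_momentum_le hm hM b
    _ = _ := by
        simp
        ring

theorem wickInt_sub_truncWick_eq (hL : L < 2 * Real.pi) {N n : ℕ} (hn : n = 2 ∨ n = 3 ∨ n = 4)
    (M : ℕ) (x : modes N → ℝ) :
    ((wickInt L N n x - truncWick L N M n x : ℝ) : ℂ)
      = ∫ y, tensorPoly (fun κ : Fin n → modes N => (diffTensor L M κ : ℂ))
          (fun k => (x k, y k)) ∂(realGaussian fun k => modeVar L k) := by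
  have hL₀ : 0 < L := Fact.out
  have hcont : ∀ T : (Fin n → modes N) → ℂ, Integrable
      (fun y : modes N → ℝ => tensorPoly T fun k => (x k, y k))
      (realGaussian fun k => modeVar L k) := fun T =>
    integrable_finsetSum _ fun κ _ => (integrable_prod_toC _ x κ).const_mul _
  have h := fun K => integral_tensorPoly_eq (fun k : modes N => modeVar L k) volume
    (fun (k : modes N) (x : Torus L) => truncMode L K k.1 x)
    (fun κ => integrable_prod_truncMode (n := n) K κ) (sum_truncMode_sq hL₀ hL N K) hn x
  rw [← truncWick_of_le le_rfl, Complex.ofReal_sub, truncWick, truncWick, ← h N, ← h M,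
    ← integral_sub (hcont _) (hcont _)]
  refine integral_congr_ae (ae_of_all _ fun y => ?_)
  simp only [tensorPoly, diffTensor, truncMode_of_le le_rfl, ← Finset.sum_sub_distrib]
  push_cast
  exact Finset.sum_congr rfl fun κ _ => by ring

/-- Moments of the high frequency part of the Wick powers: polynomial growth in the order of the
moment, and polynomial decay in the level of the truncation. The power `12` is not optimal. -/
theorem exists_moment_bound (hL : L < 2 * Real.pi) : ∃ B : ℝ, 0 ≤ B ∧
    ∀ N M n p : ℕ, 1 ≤ M → (n = 2 ∨ n = 3 ∨ n = 4) →
      Integrable (fun v => (wickInt L N n v - truncWick L N M n v) ^ (2 * p)) (gaussPerp L N) ∧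
      ∫ v, (wickInt L N n v - truncWick L N M n v) ^ (2 * p) ∂(gaussPerp L N)
        ≤ (B * (p : ℝ) ^ 12 * (M : ℝ) ^ (-(1 / 2) : ℝ)) ^ p := by
  have hL₀ : 0 < L := Fact.out
  have hA := eigConst_pos hL₀ hL
  have hG := latticeConst_nonneg
  set b : ℕ → ℝ := fun m => (L⁻¹ ^ (m + 1) * L ^ 2) ^ 2 * 2 ^ (m + 1) * eigConst L ^ (m + 1)
    * 2 ^ (m + 1) * ((m + 1) * latticeConst ^ m) with hb
  have hb0 : ∀ m, 0 ≤ b m := fun m => by positivity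
  refine ⟨16 ^ 4 * 4 ^ 12 * ∑ m ∈ Finset.range 4, b m,
    mul_nonneg (by norm_num) (Finset.sum_nonneg fun m _ => hb0 m), fun N M n p hM hn => ?_⟩
  obtain ⟨m, rfl, hm⟩ : ∃ m, n = m + 1 ∧ m ≤ 3 := ⟨n - 1, by omega, by omega⟩
  have hM0 : 0 ≤ (M : ℝ) ^ (-(1 / 2) : ℝ) := Real.rpow_nonneg (Nat.cast_nonneg _) _
  have hmeas : AEStronglyMeasurable (fun v => wickInt L N (m + 1) v - truncWick L N M (m + 1) v)
      (realGaussian fun k : modes N => modeVar L k) := by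
    simp_rw [← truncWick_of_le (L := L) (le_refl N)]
    exact ((stronglyMeasurable_truncWick N N _).sub
      (stronglyMeasurable_truncWick N M _)).aestronglyMeasurable
  rw [gaussPerp_eq hL₀ hL]
  obtain ⟨h1, h2⟩ := integral_pow_average_le (fun k : modes N => modeVar L k)
    (fun κ : Fin (m + 1) → modes N => (diffTensor L M κ : ℂ)) _ hmeas
    (wickInt_sub_truncWick_eq hL hn M) p
  refine ⟨h1, h2.trans ?_⟩
  have hS : ∑ κ : Fin (m + 1) → modes N, ‖(diffTensor L M κ : ℂ)‖ ^ 2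
        * ∏ j, (modeVar L (κ j) : ℝ)
      ≤ (∑ m ∈ Finset.range 4, b m) * (M : ℝ) ^ (-(1 / 2) : ℝ) := by
    simp_rw [Complex.norm_real, Real.norm_eq_abs, sq_abs]
    refine (sum_diffTensor_sq_le hL hm hM).trans (mul_le_mul_of_nonneg_right ?_ hM0)
    exact Finset.single_le_sum (f := b) (fun m _ => hb0 m) (Finset.mem_range.2 (by omega))
  have hS0 : 0 ≤ ∑ κ : Fin (m + 1) → modes N, ‖(diffTensor L M κ : ℂ)‖ ^ 2
        * ∏ j, (modeVar L (κ j) : ℝ) :=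
    Finset.sum_nonneg fun κ _ => mul_nonneg (sq_nonneg _)
      (Finset.prod_nonneg fun _ _ => NNReal.coe_nonneg _)
  have hle : p * (m + 1) ≤ p * 4 := Nat.mul_le_mul_left _ (by omega)
  have hfac : (((p * (m + 1))! : ℕ) : ℝ) ≤ ((p * 4 : ℕ) : ℝ) ^ (p * 4) := by
    exact_mod_cast (Nat.factorial_le hle).trans (Nat.factorial_le_pow _)
  calc (16 : ℝ) ^ (p * (m + 1)) * ((p * (m + 1))! : ℝ) ^ 3
        * (∑ κ : Fin (m + 1) → modes N, ‖(diffTensor L M κ : ℂ)‖ ^ 2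
          * ∏ j, (modeVar L (κ j) : ℝ)) ^ p
      ≤ 16 ^ (p * 4) * (((p * 4 : ℕ) : ℝ) ^ (p * 4)) ^ 3
        * ((∑ m ∈ Finset.range 4, b m) * (M : ℝ) ^ (-(1 / 2) : ℝ)) ^ p := by
        gcongr
        norm_num
    _ = _ := by
        push_cast
        rw [← pow_mul, mul_comm p 4, pow_mul, show 4 * p * 3 = 12 * p by ring, pow_mul, ← mul_pow,
          ← mul_pow]
        congr 1
        ring

/-- The classical potential is positive because the quadratic form `3/2 a² + μ a b + μ/4 b²` is
positive definite for `0 < μ < 3/2`; the Wick counterterms cost at most `a² C + (1 + C)²`, up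
to constants. -/
theorem wick_potential_lower_bound {μ : ℝ} (hμ₀ : 0 < μ) (hμ₁ : μ < 3 / 2) {C t e : ℝ} (hC : 0 ≤ C)
    (ht0 : 0 ≤ t) (ht1 : t ≤ 1) (he : 0 ≤ e) (a u : ℝ) :
    -((3 / 2 + 3 * μ / 2) * (a ^ 2 * C)
        + (3 * μ * (1 + e)) ^ 2 / (4 * (μ * (3 / 2 - μ) / 6)) * (1 + C) ^ 2)
      ≤ 3 / 2 * a ^ 2 * (u ^ 2 - C) + μ * (-(3 * t ^ 2 * e) * (u ^ 2 - C)
        + a * t * (u ^ 3 - 3 * C * u) + 1 / 4 * t ^ 2 * (u ^ 4 - 6 * C * u ^ 2 + 3 * C ^ 2)) := by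
  -- `c` is what remains of `μ / 4` after completing the square in `a`.
  set c : ℝ := μ * (3 / 2 - μ) / 6 with hc
  have hc0 : 0 < c := by
    have := mul_pos hμ₀ (sub_pos.2 hμ₁)
    positivity
  set β : ℝ := 3 * μ * (1 + e) * (1 + C) with hβ
  have h1 : c * (t * u) ^ 2 * u ^ 2
      ≤ u ^ 2 * (3 / 2 * a ^ 2 + μ * a * (t * u) + μ / 4 * (t * u) ^ 2) := by
    have : 3 / 2 * a ^ 2 + μ * a * (t * u) + μ / 4 * (t * u) ^ 2
        = 3 / 2 * (a + μ * (t * u) / 3) ^ 2 + c * (t * u) ^ 2 := by rw [hc]; ring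
    rw [this]
    nlinarith [mul_nonneg (sq_nonneg u) (sq_nonneg (a + μ * (t * u) / 3))]
  have h2 : 0 ≤ 3 * μ * C / 2 * (a - t * u) ^ 2 := by positivity
  have h3 : 0 ≤ 3 * μ * (C * e + 1) * (t * u) ^ 2 := by positivity
  have h4 : 0 ≤ 3 * μ * t ^ 2 * e * C := by positivity
  have h5 : 0 ≤ 3 / 4 * μ * t ^ 2 * C ^ 2 := by positivity
  have h6 : -(β ^ 2 / (4 * c)) ≤ t ^ 2 * (c * u ^ 4 - β * u ^ 2) := by
    have hsq : c * u ^ 4 - β * u ^ 2 + β ^ 2 / (4 * c) = c * (u ^ 2 - β / (2 * c)) ^ 2 := by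
      field_simp
      ring
    have h7 : 0 ≤ c * (u ^ 2 - β / (2 * c)) ^ 2 := by positivity
    have h8 : 0 ≤ β ^ 2 / (4 * c) := by positivity
    have ht2 : t ^ 2 ≤ 1 := pow_le_one₀ ht0 ht1
    nlinarith [mul_nonneg (sq_nonneg t) h7, mul_nonneg (sub_nonneg.2 ht2) h8]
  have h9 : (3 * μ * (1 + e)) ^ 2 / (4 * c) * (1 + C) ^ 2 = β ^ 2 / (4 * c) := by rw [hβ]; ring
  rw [h9]
  have key : t ^ 2 * (c * u ^ 4 - β * u ^ 2)
      = c * (t * u) ^ 2 * u ^ 2 - β * (t * u) ^ 2 := by ring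
  rw [key] at h6
  rw [hβ] at h6
  linarith [h1, h2, h3, h4, h5, h6]

/-- Nelson's lower bound on the interaction, divergent only logarithmically with the cutoff. -/
theorem exists_truncInteraction_lower_bound (hL : L < 2 * Real.pi) {μ : ℝ} (hμ₀ : 0 < μ)
    (hμ₁ : μ < 3 / 2) : ∃ K : ℝ, 0 ≤ K ∧ ∀ (N M : ℕ) (ε z₀ : ℝ), 1 ≤ M → 0 < ε → ε < 1 →
      ∀ v, -(K * (z₀ ^ 2 * (1 + Real.log M) + (1 + Real.log M) ^ 2))
        ≤ truncInteraction L N M μ ε z₀ v := by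
  have hL₀ : 0 < L := Fact.out
  have hA := eigConst_pos hL₀ hL
  set e : ℝ := 1 / (2 * L ^ 2) with he
  have he0 : 0 ≤ e := by positivity
  set c₁ : ℝ := (3 / 2 + 3 * μ / 2) with hc₁
  set c₂ : ℝ := (3 * μ * (1 + e)) ^ 2 / (4 * (μ * (3 / 2 - μ) / 6)) with hc₂
  have hc₁0 : 0 ≤ c₁ := by positivity
  have hc₂0 : 0 ≤ c₂ := by
    have := mul_pos hμ₀ (sub_pos.2 hμ₁)
    positivity
  set D : ℝ := 8 * eigConst L / L ^ 2 with hD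
  have hD0 : 0 ≤ D := by positivity
  refine ⟨c₁ * D + L ^ 2 * c₂ * (1 + D) ^ 2, by positivity, fun N M ε z₀ hM hε₀ hε₁ v => ?_⟩
  set C := truncConst L N M with hC
  have hC0 : 0 ≤ C := truncConst_nonneg hL₀ hL N M
  have hCle : C ≤ D * (1 + Real.log M) := truncConst_le hL₀ hL N M
  have hlog : 0 ≤ Real.log M := Real.log_nonneg (by exact_mod_cast hM)
  set l := 1 + Real.log M with hl
  have hl1 : 1 ≤ l := by linarith
  have hi := fun n => integrable_hermite_truncMode (L := L) N M n v
  set u : Torus L → ℝ := fun x => ∑ k, v k * truncMode L M k.1 x with hu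
  have heq : truncInteraction L N M μ ε z₀ v
      = ∫ x : Torus L, (3 * z₀ ^ 2 / (2 * L ^ 2) * (hermiteC C 2).eval (u x)
        + μ * (-(3 * ε / (2 * L ^ 2)) * (hermiteC C 2).eval (u x)
          + z₀ / L * √ε * (hermiteC C 3).eval (u x) + 1 / 4 * ε * (hermiteC C 4).eval (u x))) := by
    have i2 := hi 2
    have i3 := hi 3
    have i4 := hi 4
    have j1 : Integrable fun x : Torus L => -(3 * ε / (2 * L ^ 2)) * (hermiteC C 2).eval (u x)
        + z₀ / L * √ε * (hermiteC C 3).eval (u x) := (i2.const_mul _).add (i3.const_mul _)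
    have j2 : Integrable fun x : Torus L => -(3 * ε / (2 * L ^ 2)) * (hermiteC C 2).eval (u x)
        + z₀ / L * √ε * (hermiteC C 3).eval (u x) + 1 / 4 * ε * (hermiteC C 4).eval (u x) :=
      j1.add (i4.const_mul _)
    rw [integral_add (i2.const_mul _) (j2.const_mul _), integral_const_mul, integral_const_mul,
      integral_add j1 (i4.const_mul _), integral_add (i2.const_mul _) (i3.const_mul _),
      integral_const_mul, integral_const_mul, integral_const_mul]
    rfl
  have hpt : ∀ x : Torus L, -(c₁ * ((z₀ / L) ^ 2 * C) + c₂ * (1 + C) ^ 2)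
      ≤ 3 * z₀ ^ 2 / (2 * L ^ 2) * (hermiteC C 2).eval (u x)
        + μ * (-(3 * ε / (2 * L ^ 2)) * (hermiteC C 2).eval (u x)
          + z₀ / L * √ε * (hermiteC C 3).eval (u x) + 1 / 4 * ε * (hermiteC C 4).eval (u x)) := by
    intro x
    refine (wick_potential_lower_bound hμ₀ hμ₁ hC0 (Real.sqrt_nonneg ε)
      (Real.sqrt_le_one.2 hε₁.le) he0 (z₀ / L) (u x)).trans_eq ?_
    rw [eval_hermiteC_two, eval_hermiteC_three, eval_hermiteC_four, Real.sq_sqrt hε₀.le, he]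
    field_simp
  have hint : ∫ _ : Torus L, -(c₁ * ((z₀ / L) ^ 2 * C) + c₂ * (1 + C) ^ 2)
      ≤ truncInteraction L N M μ ε z₀ v := by
    rw [heq]
    refine integral_mono (integrable_const _) ?_ hpt
    exact ((hi 2).const_mul _).add
      (((((hi 2).const_mul _).add ((hi 3).const_mul _)).add ((hi 4).const_mul _)).const_mul _)
  refine le_trans ?_ hint
  rw [integral_const, volume_real_torus, smul_eq_mul, mul_neg, neg_le_neg_iff]
  calc L ^ 2 * (c₁ * ((z₀ / L) ^ 2 * C) + c₂ * (1 + C) ^ 2)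
      = c₁ * z₀ ^ 2 * C + L ^ 2 * c₂ * (1 + C) ^ 2 := by field_simp
    _ ≤ c₁ * z₀ ^ 2 * (D * l) + L ^ 2 * c₂ * ((1 + D) * l) ^ 2 := by
        gcongr
        nlinarith
    _ ≤ c₁ * z₀ ^ 2 * (D * l) + L ^ 2 * c₂ * ((1 + D) * l) ^ 2
        + (c₁ * D * l ^ 2 + L ^ 2 * c₂ * (1 + D) ^ 2 * (z₀ ^ 2 * l)) :=
        le_add_of_nonneg_right (by positivity)
    _ = _ := by ring

end Truncation

/-! ### Nelson's estimate -/

section Nelson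

theorem add_add_pow_two_mul_le (x y z : ℝ) (p : ℕ) :
    (x + y + z) ^ (2 * p) ≤ 9 ^ p * (x ^ (2 * p) + y ^ (2 * p) + z ^ (2 * p)) := by
  have hm : |x + y + z| ≤ 3 * max |x| (max |y| |z|) := by
    have h1 := le_max_left |x| (max |y| |z|)
    have h2 := (le_max_left |y| |z|).trans (le_max_right |x| (max |y| |z|))
    have h3 := (le_max_right |y| |z|).trans (le_max_right |x| (max |y| |z|))
    have := abs_add_three x y z
    linarith
  have hx := (even_two_mul p).pow_nonneg x
  have hy := (even_two_mul p).pow_nonneg y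
  have hz := (even_two_mul p).pow_nonneg z
  have key : max |x| (max |y| |z|) ^ (2 * p) ≤ x ^ (2 * p) + y ^ (2 * p) + z ^ (2 * p) := by
    rcases max_choice |x| (max |y| |z|) with h | h
    · rw [h, (even_two_mul p).pow_abs]; linarith
    · rw [h]
      rcases max_choice |y| |z| with h' | h' <;> rw [h', (even_two_mul p).pow_abs] <;> linarith
  calc (x + y + z) ^ (2 * p) = |x + y + z| ^ (2 * p) := ((even_two_mul p).pow_abs _).symm
    _ ≤ (3 * max |x| (max |y| |z|)) ^ (2 * p) :=
        pow_le_pow_left₀ (abs_nonneg _) hm _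
    _ = 9 ^ p * max |x| (max |y| |z|) ^ (2 * p) := by rw [mul_pow, pow_mul 3]; norm_num
    _ ≤ _ := by gcongr

theorem mul_pow_two_mul_le {c d R : ℝ} (hc : |c| ≤ R) (p : ℕ) :
    (c * d) ^ (2 * p) ≤ (R ^ 2) ^ p * d ^ (2 * p) := by
  rw [mul_pow, pow_mul c]
  refine mul_le_mul_of_nonneg_right ?_ ((even_two_mul p).pow_nonneg d)
  exact pow_le_pow_left₀ (sq_nonneg _) (sq_le_sq' (abs_le.1 hc).1 (abs_le.1 hc).2) p

variable {L : ℝ} [Fact (0 < L)]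

theorem measurable_truncInteraction (N M : ℕ) (μ ε z₀ : ℝ) :
    Measurable (truncInteraction L N M μ ε z₀) := by
  have := fun n => (stronglyMeasurable_truncWick (L := L) N M n).measurable
  unfold truncInteraction
  fun_prop

theorem exists_interaction_moment_bound (hL : L < 2 * Real.pi) {μ : ℝ} (hμ₀ : 0 < μ) :
    ∃ B : ℝ, 0 ≤ B ∧ ∀ (N M p : ℕ) (ε z₀ : ℝ), 1 ≤ M → 0 < ε → ε < 1 →
      Integrable (fun v => (interaction L N μ ε z₀ v - truncInteraction L N M μ ε z₀ v) ^ (2 * p))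
        (gaussPerp L N) ∧
      ∫ v, (interaction L N μ ε z₀ v - truncInteraction L N M μ ε z₀ v) ^ (2 * p)
          ∂(gaussPerp L N)
        ≤ 3 * (B * (1 + z₀ ^ 2) ^ 2 * (p : ℝ) ^ 12 * (M : ℝ) ^ (-(1 / 2) : ℝ)) ^ p := by
  have hL₀ : 0 < L := Fact.out
  obtain ⟨B, hB, hmom⟩ := exists_moment_bound (L := L) hL
  set c : ℝ := 3 * (1 + μ) / (2 * L ^ 2) + μ / L + μ with hc
  have hc0 : 0 ≤ c := by positivity
  refine ⟨9 * c ^ 2 * B, by positivity, fun N M p ε z₀ hM hε₀ hε₁ => ?_⟩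
  set R : ℝ := c * (1 + z₀ ^ 2) with hR
  have hz : |z₀| ≤ 1 + z₀ ^ 2 := abs_le.2 ⟨by nlinarith [sq_nonneg (z₀ + 1)],
    by nlinarith [sq_nonneg (z₀ - 1)]⟩
  have hsq : √ε ≤ 1 := Real.sqrt_le_one.2 hε₁.le
  have hc2 : |3 * z₀ ^ 2 / (2 * L ^ 2) - μ * (3 * ε / (2 * L ^ 2))| ≤ R := by
    have h1 : |3 * z₀ ^ 2 / (2 * L ^ 2) - μ * (3 * ε / (2 * L ^ 2))|
        ≤ 3 * z₀ ^ 2 / (2 * L ^ 2) + μ * (3 * ε / (2 * L ^ 2)) := by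
      refine (abs_sub _ _).trans_eq ?_
      rw [abs_of_nonneg (by positivity), abs_of_nonneg (by positivity)]
    refine h1.trans ?_
    calc 3 * z₀ ^ 2 / (2 * L ^ 2) + μ * (3 * ε / (2 * L ^ 2))
        ≤ 3 * (1 + z₀ ^ 2) / (2 * L ^ 2) + μ * (3 * (1 + z₀ ^ 2) / (2 * L ^ 2)) := by
          gcongr <;> nlinarith [sq_nonneg z₀]
      _ = 3 * (1 + μ) / (2 * L ^ 2) * (1 + z₀ ^ 2) := by ring
      _ ≤ R := by
          rw [hR, hc]
          have : 0 ≤ (μ / L + μ) * (1 + z₀ ^ 2) := by positivity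
          linarith
  have hc3 : |μ * (z₀ / L * √ε)| ≤ R := by
    rw [abs_mul, abs_mul, abs_div, abs_of_pos hμ₀, abs_of_pos hL₀,
      abs_of_nonneg (Real.sqrt_nonneg ε)]
    calc μ * (|z₀| / L * √ε) ≤ μ * ((1 + z₀ ^ 2) / L * 1) := by gcongr
      _ = μ / L * (1 + z₀ ^ 2) := by ring
      _ ≤ R := by
          rw [hR, hc]
          have : 0 ≤ (3 * (1 + μ) / (2 * L ^ 2) + μ) * (1 + z₀ ^ 2) := by positivity
          linarith
  have hc4 : |μ * (1 / 4 * ε)| ≤ R := by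
    rw [abs_of_nonneg (by positivity)]
    calc μ * (1 / 4 * ε) ≤ μ * 1 := by gcongr; linarith
      _ ≤ μ * (1 + z₀ ^ 2) := by gcongr; nlinarith [sq_nonneg z₀]
      _ ≤ R := by
          rw [hR, hc]
          have : 0 ≤ (3 * (1 + μ) / (2 * L ^ 2) + μ / L) * (1 + z₀ ^ 2) := by positivity
          linarith
  set D : ℕ → (modes N → ℝ) → ℝ := fun n v => wickInt L N n v - truncWick L N M n v with hD
  have hpt : ∀ v, (interaction L N μ ε z₀ v - truncInteraction L N M μ ε z₀ v) ^ (2 * p)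
      ≤ (9 * R ^ 2) ^ p * (D 2 v ^ (2 * p) + D 3 v ^ (2 * p) + D 4 v ^ (2 * p)) := by
    intro v
    have : interaction L N μ ε z₀ v - truncInteraction L N M μ ε z₀ v
        = (3 * z₀ ^ 2 / (2 * L ^ 2) - μ * (3 * ε / (2 * L ^ 2))) * D 2 v
          + μ * (z₀ / L * √ε) * D 3 v + μ * (1 / 4 * ε) * D 4 v := by
      simp only [interaction, truncInteraction, hD]; ring
    rw [this, mul_pow 9, mul_assoc (9 ^ p)]
    have h9 : (0 : ℝ) ≤ 9 ^ p := by positivity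
    refine (add_add_pow_two_mul_le _ _ _ p).trans (mul_le_mul_of_nonneg_left ?_ h9)
    rw [mul_add, mul_add]
    exact add_le_add_three (mul_pow_two_mul_le hc2 p) (mul_pow_two_mul_le hc3 p)
      (mul_pow_two_mul_le hc4 p)
  have hnn : ∀ v, 0 ≤ (interaction L N μ ε z₀ v - truncInteraction L N M μ ε z₀ v) ^ (2 * p) :=
    fun v => (even_two_mul p).pow_nonneg _
  obtain ⟨i2, b2⟩ := hmom N M 2 p hM (by norm_num)
  obtain ⟨i3, b3⟩ := hmom N M 3 p hM (by norm_num)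
  obtain ⟨i4, b4⟩ := hmom N M 4 p hM (by norm_num)
  have i23 : Integrable (fun v => D 2 v ^ (2 * p) + D 3 v ^ (2 * p)) (gaussPerp L N) := i2.add i3
  have i234 : Integrable (fun v => D 2 v ^ (2 * p) + D 3 v ^ (2 * p) + D 4 v ^ (2 * p))
      (gaussPerp L N) := i23.add i4
  have hmeas : Measurable fun v : modes N → ℝ =>
      (interaction L N μ ε z₀ v - truncInteraction L N M μ ε z₀ v) ^ (2 * p) := by
    simp_rw [← truncInteraction_of_le (L := L) (le_refl N)]
    exact ((measurable_truncInteraction N N μ ε z₀).sub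
      (measurable_truncInteraction N M μ ε z₀)).pow_const _
  refine ⟨(i234.const_mul ((9 * R ^ 2) ^ p)).mono' hmeas.aestronglyMeasurable
    (ae_of_all _ fun v => ?_), ?_⟩
  · rw [Real.norm_of_nonneg (hnn v)]
    exact hpt v
  · refine (integral_mono_of_nonneg (ae_of_all _ hnn) (i234.const_mul _)
      (ae_of_all _ hpt)).trans ?_
    rw [integral_const_mul, integral_add i23 i4, integral_add i2 i3]
    calc _ ≤ (9 * R ^ 2) ^ p * (3 * (B * (p : ℝ) ^ 12 * (M : ℝ) ^ (-(1 / 2) : ℝ)) ^ p) := by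
          gcongr
          linarith
      _ = _ := by
          rw [mul_left_comm, ← mul_pow, hR]
          congr 2
          ring

/-- The deterministic part of Nelson's argument. Among the levels `j` with `u j` close to `w`, the
first one gives a lower bound on `w`, and unless it is `j₀` the level before it is not close. -/
theorem exp_neg_le_sum_levels {w : ℝ} {u b : ℕ → ℝ} (p : ℕ → ℕ) {j₀ J : ℕ} (hJ : j₀ ≤ J)
    (hu : ∀ j, j₀ ≤ j → -b j ≤ u j) (hw : u J = w) :
    Real.exp (-w) ≤ Real.exp (b j₀ + 1)
      + ∑ j ∈ Finset.Ico j₀ J, Real.exp (b (j + 1) + 1) * (w - u j) ^ (2 * p j) := by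
  have hnn : ∀ j, 0 ≤ Real.exp (b (j + 1) + 1) * (w - u j) ^ (2 * p j) := fun j =>
    mul_nonneg (Real.exp_pos _).le ((even_two_mul _).pow_nonneg _)
  have hex : ∃ j, j₀ ≤ j ∧ |w - u j| ≤ 1 := ⟨J, hJ, by simp [hw]⟩
  classical
  obtain ⟨h1, h2⟩ := Nat.find_spec hex
  have hle : Nat.find hex ≤ J := Nat.find_min' hex ⟨hJ, by simp [hw]⟩
  have hmin : ∀ {j}, j < Nat.find hex → ¬ (j₀ ≤ j ∧ |w - u j| ≤ 1) := fun h => Nat.find_min hex h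
  generalize Nat.find hex = j at h1 h2 hle hmin
  have hexp : Real.exp (-w) ≤ Real.exp (b j + 1) := by
    refine Real.exp_le_exp.2 ?_
    have := hu j h1
    have := (abs_le.1 h2).1
    linarith
  rcases h1.eq_or_lt with rfl | hlt
  · exact hexp.trans (le_add_of_nonneg_right (Finset.sum_nonneg fun j _ => hnn j))
  · obtain ⟨i, rfl⟩ : ∃ i, j = i + 1 := ⟨j - 1, by omega⟩
    have hi : 1 ≤ |w - u i| := by
      by_contra! h
      exact hmin (Nat.lt_succ_self i) ⟨by omega, h.le⟩
    have hterm : Real.exp (b (i + 1) + 1)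
        ≤ Real.exp (b (i + 1) + 1) * (w - u i) ^ (2 * p i) := by
      refine le_mul_of_one_le_right (Real.exp_pos _).le ?_
      rw [← (even_two_mul _).pow_abs]
      exact one_le_pow₀ hi
    have hsum := Finset.single_le_sum
      (f := fun j => Real.exp (b (j + 1) + 1) * (w - u j) ^ (2 * p j))
      (fun j _ => hnn j) (Finset.mem_Ico.2 ⟨by omega, by omega⟩ : i ∈ Finset.Ico j₀ J)
    have := Real.exp_pos (b j₀ + 1)
    linarith

/-- At the cutoff `M = j ^ 80`, the hypercontractive bound on the moment of order `2 j ^ 3` is at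
most `exp (-j ^ 3)`: the decay `M ^ (-1/2) = j ^ (-40)` absorbs `(1 + z) ^ 2 ≤ j ^ 2` and
`(j ^ 3) ^ 12 = j ^ 36`, and leaves `B / j ^ 2 ≤ 1 / 3`. -/
theorem level_moment_le {B z : ℝ} (hB : 0 ≤ B) (hz0 : 0 ≤ z) {j : ℕ} (hj : 3 * B + 1 ≤ j)
    (hz : 1 + z ≤ j) :
    (B * (1 + z) ^ 2 * ((j ^ 3 : ℕ) : ℝ) ^ 12 * ((j ^ 80 : ℕ) : ℝ) ^ (-(1 / 2) : ℝ)) ^ (j ^ 3)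
      ≤ Real.exp (-(j : ℝ) ^ 3) := by
  have hz1 : 0 ≤ 1 + z := add_nonneg zero_le_one hz0
  have hj1 : (1 : ℝ) ≤ j := by linarith
  have hj0 : (0 : ℝ) < j := by linarith
  have hrpow : ((j ^ 80 : ℕ) : ℝ) ^ (-(1 / 2) : ℝ) = ((j : ℝ) ^ 40)⁻¹ := by
    rw [Nat.cast_pow, ← Real.rpow_natCast, ← Real.rpow_mul hj0.le, ← Real.rpow_natCast,
      ← Real.rpow_neg hj0.le]
    norm_num
  have hthird : 1 / 3 ≤ Real.exp (-1) := by
    rw [Real.exp_neg, one_div]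
    exact inv_anti₀ (Real.exp_pos _) (Real.exp_one_lt_d9.le.trans (by norm_num))
  have hbase : B * (1 + z) ^ 2 * ((j ^ 3 : ℕ) : ℝ) ^ 12 * ((j ^ 80 : ℕ) : ℝ) ^ (-(1 / 2) : ℝ)
      ≤ Real.exp (-1) := by
    rw [hrpow]
    calc B * (1 + z) ^ 2 * ((j ^ 3 : ℕ) : ℝ) ^ 12 * ((j : ℝ) ^ 40)⁻¹
        ≤ B * (j : ℝ) ^ 2 * ((j ^ 3 : ℕ) : ℝ) ^ 12 * ((j : ℝ) ^ 40)⁻¹ := by gcongr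
      _ = B / (j : ℝ) ^ 2 := by push_cast; field_simp
      _ ≤ 1 / 3 := by
          rw [div_le_div_iff₀ (by positivity) (by norm_num)]
          nlinarith
      _ ≤ _ := hthird
  calc _ ≤ Real.exp (-1) ^ (j ^ 3) := pow_le_pow_left₀ (by positivity) hbase _
    _ = Real.exp (-(j : ℝ) ^ 3) := by
        rw [← Real.exp_nat_mul]
        push_cast
        ring_nf

theorem one_add_log_pow_le {j : ℕ} (hj : 1 ≤ j) : 1 + Real.log ((j ^ 80 : ℕ) : ℝ) ≤ 81 * j := by
  have hj0 : (1 : ℝ) ≤ j := by exact_mod_cast hj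
  have := Real.log_le_sub_one_of_pos (show (0 : ℝ) < j by linarith)
  rw [Nat.cast_pow, Real.log_pow]
  push_cast
  linarith

/-- From level `j` on, the moments beat the divergence of the lower bound at level `j + 1`. -/
theorem level_term_le {K z : ℝ} (hK : 0 ≤ K) {j : ℕ}
    (hj : 6642 * K * 4 + 2 ≤ j) (hz : 1 + z ≤ j) :
    Real.exp (K * (z * (1 + Real.log (((j + 1) ^ 80 : ℕ) : ℝ))
        + (1 + Real.log (((j + 1) ^ 80 : ℕ) : ℝ)) ^ 2) + 1) * Real.exp (-(j : ℝ) ^ 3)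
      ≤ (1 / 2) ^ j := by
  have hj1 : (1 : ℝ) ≤ j := by linarith
  have hl := one_add_log_pow_le (Nat.le_add_left 1 j)
  set l := 1 + Real.log (((j + 1) ^ 80 : ℕ) : ℝ) with hldef
  have hl0 : 0 ≤ l := by
    have : 0 ≤ Real.log (((j + 1) ^ 80 : ℕ) : ℝ) := Real.log_natCast_nonneg _
    linarith
  push_cast at hl
  -- `6642 = 81 + 81 ^ 2` and `(j + 1) ^ 2 ≤ 4 j ^ 2`.
  have h1 : z * l + l ^ 2 ≤ 6642 * (4 * (j : ℝ) ^ 2) := by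
    have ha : z * l ≤ (j + 1) * (81 * (j + 1)) := by gcongr; linarith
    have hb : l ^ 2 ≤ (81 * ((j : ℝ) + 1)) ^ 2 := by gcongr
    nlinarith
  have h2 : K * (z * l + l ^ 2) + 1 + -(j : ℝ) ^ 3 ≤ -(j : ℝ) := by
    have ha : K * (z * l + l ^ 2) ≤ K * (6642 * (4 * (j : ℝ) ^ 2)) := by gcongr
    have hb : (6642 * K * 4 + 2) * (j : ℝ) ^ 2 ≤ j * (j : ℝ) ^ 2 := by gcongr
    nlinarith
  have hhalf : Real.exp (-1) ≤ 1 / 2 := by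
    rw [Real.exp_neg, one_div]
    exact inv_anti₀ two_pos (by linarith [Real.add_one_le_exp (1 : ℝ)])
  rw [← Real.exp_add]
  calc _ ≤ Real.exp (-(j : ℝ)) := Real.exp_le_exp.2 h2
    _ = Real.exp (-1) ^ j := by rw [← Real.exp_nat_mul]; ring_nf
    _ ≤ _ := pow_le_pow_left₀ (Real.exp_pos _).le hhalf _

/-- Nelson's estimate, with an explicit first level `j`, which has to be of order `1 + z₀²`. -/
theorem exists_nelson_bound (hL : L < 2 * Real.pi) {μ : ℝ} (hμ₀ : 0 < μ) (hμ₁ : μ < 3 / 2) :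
    ∃ (K : ℝ) (m : ℕ), 0 ≤ K ∧ ∀ (N j : ℕ) (ε z₀ : ℝ), 0 < ε → ε < 1 → m ≤ j → 1 + z₀ ^ 2 ≤ j →
      Integrable (fun v => Real.exp (-interaction L N μ ε z₀ v)) (gaussPerp L N) ∧
      ∫ v, Real.exp (-interaction L N μ ε z₀ v) ∂(gaussPerp L N)
        ≤ Real.exp (K * (z₀ ^ 2 * (1 + 80 * Real.log j) + (1 + 80 * Real.log j) ^ 2) + 1) + 6 := by
  have hL₀ : 0 < L := Fact.out
  obtain ⟨K, hK, hlow⟩ := exists_truncInteraction_lower_bound (L := L) hL hμ₀ hμ₁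
  obtain ⟨B, hB, hmom⟩ := exists_interaction_moment_bound (L := L) hL hμ₀
  refine ⟨K, ⌈3 * B + 1⌉₊ + ⌈6642 * K * 4 + 2⌉₊, hK, fun N j₀ ε z₀ hε₀ hε₁ hm hz => ?_⟩
  have hprob : IsProbabilityMeasure (gaussPerp L N) := by
    rw [gaussPerp_eq hL₀ hL]; infer_instance
  set w := interaction L N μ ε z₀ with hw
  set u : ℕ → (modes N → ℝ) → ℝ := fun j => truncInteraction L N (j ^ 80) μ ε z₀ with hu
  set b : ℕ → ℝ := fun j => K * (z₀ ^ 2 * (1 + Real.log ((j ^ 80 : ℕ) : ℝ))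
    + (1 + Real.log ((j ^ 80 : ℕ) : ℝ)) ^ 2) with hb
  have hj₀ : 1 ≤ j₀ := by
    have : (1 : ℝ) ≤ j₀ := by nlinarith [sq_nonneg z₀]
    exact_mod_cast this
  have hpow : ∀ {j}, 1 ≤ j → 1 ≤ j ^ 80 := fun h => Nat.one_le_pow _ _ h
  set J := max j₀ N with hJ
  have hNJ : N ≤ J ^ 80 := (le_max_right j₀ N).trans (Nat.le_self_pow (by norm_num) J)
  have hpt : ∀ v, Real.exp (-w v) ≤ Real.exp (b j₀ + 1)
      + ∑ j ∈ Finset.Ico j₀ J, Real.exp (b (j + 1) + 1) * (w v - u j v) ^ (2 * j ^ 3) := fun v =>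
    exp_neg_le_sum_levels (u := fun j => u j v) (fun j => j ^ 3) (le_max_left j₀ N)
      (fun j hj => hlow N (j ^ 80) ε z₀ (hpow (hj₀.trans hj)) hε₀ hε₁ v)
      (truncInteraction_of_le hNJ μ ε z₀ v)
  have hint : ∀ j ∈ Finset.Ico j₀ J, Integrable (fun v => Real.exp (b (j + 1) + 1)
      * (w v - u j v) ^ (2 * j ^ 3)) (gaussPerp L N) := fun j hj =>
    (hmom N (j ^ 80) (j ^ 3) ε z₀ (hpow (hj₀.trans (Finset.mem_Ico.1 hj).1)) hε₀ hε₁).1.const_mul _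
  have hbound : Integrable (fun v => Real.exp (b j₀ + 1) + ∑ j ∈ Finset.Ico j₀ J,
      Real.exp (b (j + 1) + 1) * (w v - u j v) ^ (2 * j ^ 3)) (gaussPerp L N) :=
    (integrable_const _).add (integrable_finsetSum _ hint)
  have hmeas : Measurable fun v => Real.exp (-w v) := by
    have : w = truncInteraction L N N μ ε z₀ :=
      funext fun v => (truncInteraction_of_le le_rfl μ ε z₀ v).symm
    rw [this]
    exact (measurable_truncInteraction N N μ ε z₀).neg.exp
  refine ⟨hbound.mono' hmeas.aestronglyMeasurable (ae_of_all _ fun v => ?_), ?_⟩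
  · rw [Real.norm_of_nonneg (Real.exp_pos _).le]
    exact hpt v
  refine (integral_mono_of_nonneg (ae_of_all _ fun v => (Real.exp_pos _).le) hbound
    (ae_of_all _ hpt)).trans ?_
  rw [integral_add (integrable_const _) (integrable_finsetSum _ hint), integral_const,
    probReal_univ, one_smul, integral_finsetSum _ hint]
  refine add_le_add (le_of_eq ?_) ?_
  · simp only [hb, Nat.cast_pow, Real.log_pow]
    norm_num
  calc ∑ j ∈ Finset.Ico j₀ J, ∫ v, Real.exp (b (j + 1) + 1) * (w v - u j v) ^ (2 * j ^ 3)
        ∂(gaussPerp L N)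
      ≤ ∑ j ∈ Finset.Ico j₀ J, 3 * (1 / 2 : ℝ) ^ j := by
        refine Finset.sum_le_sum fun j hj => ?_
        have hj' := (Finset.mem_Ico.1 hj).1
        have hjm : ((⌈3 * B + 1⌉₊ + ⌈6642 * K * 4 + 2⌉₊ : ℕ) : ℝ) ≤ j := by
          exact_mod_cast hm.trans hj'
        push_cast at hjm
        have h1 := Nat.le_ceil (3 * B + 1)
        have h2 := Nat.le_ceil (6642 * K * 4 + 2)
        have hzj : 1 + z₀ ^ 2 ≤ j := hz.trans (by exact_mod_cast hj')
        rw [integral_const_mul]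
        calc _ ≤ Real.exp (b (j + 1) + 1) * (3 * Real.exp (-(j : ℝ) ^ 3)) := by
              gcongr
              refine (hmom N (j ^ 80) (j ^ 3) ε z₀ (hpow (hj₀.trans hj')) hε₀ hε₁).2.trans ?_
              gcongr
              exact level_moment_le hB (sq_nonneg z₀) (by linarith) hzj
          _ = 3 * (Real.exp (b (j + 1) + 1) * Real.exp (-(j : ℝ) ^ 3)) := by ring
          _ ≤ 3 * (1 / 2) ^ j := by
              gcongr
              exact level_term_le hK (by linarith) hzj
    _ ≤ ∑ j ∈ Finset.range J, 3 * (1 / 2 : ℝ) ^ j :=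
        Finset.sum_le_sum_of_subset_of_nonneg
          (fun j hj => Finset.mem_range.2 (Finset.mem_Ico.1 hj).2) fun j _ _ => by positivity
    _ ≤ 6 := by
        rw [← Finset.mul_sum]
        linarith [sum_geometric_two_le J]

theorem le_two_add_mul_log {z : ℝ} (hz : 0 ≤ z) : z ≤ 2 + z * Real.log (1 + z) := by
  have hl : 0 ≤ Real.log (1 + z) := Real.log_nonneg (by linarith)
  rcases le_total z 2 with h | h
  · nlinarith
  · have h3 : 1 ≤ Real.log (1 + z) := by
      rw [Real.le_log_iff_exp_le (by linarith)]
      linarith [Real.exp_one_lt_d9]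
    nlinarith

/-- With the first level of order `1 + z₀²`, Nelson's estimate does not depend on `ε`. -/
theorem exists_exp_bound (hL : L < 2 * Real.pi) {μ : ℝ} (hμ₀ : 0 < μ) (hμ₁ : μ < 3 / 2) :
    ∃ A K : ℝ, 0 < A ∧ 0 ≤ K ∧ ∀ (N : ℕ) (ε z₀ : ℝ), 0 < ε → ε < 1 →
      Integrable (fun v => Real.exp (-interaction L N μ ε z₀ v)) (gaussPerp L N) ∧
      ∫ v, Real.exp (-interaction L N μ ε z₀ v) ∂(gaussPerp L N)
        ≤ A * Real.exp (K * (z₀ ^ 2 * Real.log (1 + z₀ ^ 2))) := by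
  obtain ⟨K, m, hK, h⟩ := exists_nelson_bound (L := L) hL hμ₀ hμ₁
  set a : ℝ := 1 + 80 * Real.log (2 + m) with ha
  have ha0 : 0 ≤ a := by
    have : 0 ≤ Real.log (2 + m) := Real.log_nonneg (by linarith [(Nat.cast_nonneg m : (0 : ℝ) ≤ m)])
    positivity
  -- `12880 = 80 + 2 * 80 ^ 2` collects the multiples of `z l` and `l ^ 2 ≤ z l` below.
  set K₁ : ℝ := K * (2 * a + 2 * a ^ 2 + 12880) with hK₁
  have hK₁0 : 0 ≤ K₁ := by positivity
  refine ⟨Real.exp (K₁ + 1) + 6, K₁, by positivity, hK₁0, fun N ε z₀ hε₀ hε₁ => ?_⟩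
  set z := z₀ ^ 2 with hz
  have hz0 : 0 ≤ z := sq_nonneg _
  set l := Real.log (1 + z) with hl
  have hl0 : 0 ≤ l := Real.log_nonneg (by linarith)
  have hlz : l ≤ z := by
    have := Real.log_le_sub_one_of_pos (show 0 < 1 + z by linarith)
    linarith
  have hm0 : (0 : ℝ) ≤ m := Nat.cast_nonneg m
  set j := ⌈z⌉₊ + 1 + m with hj
  have hj1 : 1 + z ≤ j := by
    have := Nat.le_ceil z
    rw [hj]; push_cast; linarith
  have hj2 : (j : ℝ) ≤ (2 + m) * (1 + z) := by
    have := (Nat.ceil_lt_add_one hz0).le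
    rw [hj]; push_cast
    nlinarith
  obtain ⟨h1, h2⟩ := h N j ε z₀ hε₀ hε₁ (by omega) hj1
  refine ⟨h1, h2.trans ?_⟩
  have hj0 : (0 : ℝ) < j := by linarith
  have hlog : 1 + 80 * Real.log j ≤ a + 80 * l := by
    have := Real.log_le_log hj0 hj2
    rw [Real.log_mul (by positivity) (by positivity)] at this
    rw [ha]; linarith
  have hlog0 : 0 ≤ 1 + 80 * Real.log j := by
    have : 0 ≤ Real.log j := Real.log_natCast_nonneg j
    positivity
  have hzl := le_two_add_mul_log hz0
  rw [← hl] at hzl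
  have hexp : K * (z * (1 + 80 * Real.log j) + (1 + 80 * Real.log j) ^ 2) + 1
      ≤ (K₁ + 1) + K₁ * (z * l) := by
    have hs0 : 0 ≤ z * l := mul_nonneg hz0 hl0
    have hA : z * (1 + 80 * Real.log j) + (1 + 80 * Real.log j) ^ 2
        ≤ (2 * a + 2 * a ^ 2 + 12880) * (1 + z * l) := by
      have e1 : z * (1 + 80 * Real.log j) ≤ z * (a + 80 * l) := by gcongr
      have e2 : (1 + 80 * Real.log j) ^ 2 ≤ (a + 80 * l) ^ 2 := by gcongr
      have e3 : (a + 80 * l) ^ 2 ≤ 2 * a ^ 2 + 12800 * (z * l) := by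
        nlinarith [sq_nonneg (a - 80 * l), mul_nonneg hl0 (sub_nonneg.2 hlz)]
      have e4 : a * z ≤ a * (2 + z * l) := by gcongr
      nlinarith [mul_nonneg ha0 hs0, mul_nonneg (sq_nonneg a) hs0]
    have := mul_le_mul_of_nonneg_left hA hK
    rw [hK₁]
    linarith
  have h6 : (6 : ℝ) ≤ 6 * Real.exp (K₁ * (z * l)) := by
    have := Real.one_le_exp (show 0 ≤ K₁ * (z * l) by positivity)
    linarith
  rw [add_mul, ← Real.exp_add]
  exact add_le_add (Real.exp_le_exp.2 hexp) h6

end Nelson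

end AllenCahn

end

theorem proposition5p3 (L : ℝ) [Fact (0 < L)] (hL : L < 2 * Real.pi)
    (μ : ℝ) (hμ₀ : 0 < μ) (hμ₁ : μ < 3 / 2) :
    ∃ M ε₀ : ℝ, 0 < M ∧ 0 < ε₀ ∧ ∀ (N : ℕ) (ε z₀ : ℝ), 0 < ε → ε < ε₀ →
      Integrable (fun y => Real.exp (-AllenCahn.interaction L N μ ε z₀ y))
          (AllenCahn.gaussPerp L N) ∧
        ∫ y, Real.exp (-AllenCahn.interaction L N μ ε z₀ y) ∂AllenCahn.gaussPerp L N ≤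
          M * (1 + √ε * Real.exp (M * z₀ ^ 2 * Real.log (1 + z₀ ^ 2) / √ε)) := by
  obtain ⟨A, K, hA, hK, h⟩ := AllenCahn.exists_exp_bound (L := L) hL hμ₀ hμ₁
  have hAK : 0 ≤ A * Real.exp K := by positivity
  set M : ℝ := A + A * Real.exp K + K + 1 with hM
  refine ⟨M, 1, by positivity, one_pos, fun N ε z₀ hε₀ hε₁ => ?_⟩
  obtain ⟨h1, h2⟩ := h N ε z₀ hε₀ hε₁
  refine ⟨h1, h2.trans ?_⟩
  have hr0 : 0 < √ε := Real.sqrt_pos.2 hε₀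
  have hr1 : √ε ≤ 1 := Real.sqrt_le_one.2 hε₁.le
  rw [mul_assoc M]
  set s := z₀ ^ 2 * Real.log (1 + z₀ ^ 2) with hs
  have hpos : 0 ≤ √ε * Real.exp (M * s / √ε) := by positivity
  rcases le_total s 1 with hs1 | hs1
  · calc A * Real.exp (K * s) ≤ A * Real.exp K := by
          gcongr
          nlinarith
      _ ≤ M := by linarith
      _ ≤ M * (1 + √ε * Real.exp (M * s / √ε)) :=
          le_mul_of_one_le_right (by positivity) (by linarith)
  · -- As `M ≥ K + 1`, the exponent `M s / √ε` leaves room for a factor `exp (1 / √ε) ≥ 1 / √ε`.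
    have hexp : K * s + 1 / √ε ≤ M * s / √ε := by
      rw [← sub_nonneg]
      have : M * s / √ε - (K * s + 1 / √ε)
          = ((M - K - 1) * s + (s - 1) + K * s * (1 - √ε)) / √ε := by field_simp; ring
      rw [this]
      have e1 : 0 ≤ (M - K - 1) * s := mul_nonneg (by linarith) (by linarith)
      have e2 : 0 ≤ K * s * (1 - √ε) :=
        mul_nonneg (mul_nonneg hK (by linarith)) (by linarith)
      exact div_nonneg (by linarith) hr0.le
    have hone : 1 ≤ √ε * Real.exp (1 / √ε) := by
      calc 1 = √ε * (1 / √ε) := by field_simp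
        _ ≤ √ε * Real.exp (1 / √ε) := by
            gcongr
            linarith [Real.add_one_le_exp (1 / √ε)]
    calc A * Real.exp (K * s) ≤ M * (Real.exp (K * s) * (√ε * Real.exp (1 / √ε))) := by
          gcongr
          · linarith
          · exact le_mul_of_one_le_right (Real.exp_pos _).le hone
      _ = M * (√ε * Real.exp (K * s + 1 / √ε)) := by rw [Real.exp_add]; ring
      _ ≤ M * (√ε * Real.exp (M * s / √ε)) := by gcongr
      _ ≤ _ := by gcongr; linarith
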